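/- Let $q$ be a prime power, let $b$ divide $d$, and regard $V=V'=\mathbb F_{q^b}^{d/b}$ as a $d$-dimensional vector space over $\mathbb F_q$. Write $\mathrm{Tr}_{r^k/r}$ for the relative trace $\mathbb F_{r^k}\to\mathbb F_r$. Points of a polar space on $V$ are the totally isotropic (resp. totally singular) $1$-dimensional $\mathbb F_q$-subspaces $\langle v\rangle$; its generators are the maximal totally isotropic (resp. singular) subspaces; an $m$-ovoid ($m$ a non-negative integer) is a set of points that meets every generator in exactly $m$ points. When $q^b$ is a square, put $\kappa'(x,y)=\sum_i x_iy_i^{q^{b/2}}$ and $H'(x)=\kappa'(x,x)\in\mathbb F_{q^{b/2}}$. Let $\square$ be the set of nonzero squares of $\mathbb F_q$, and let $\epsilon=\tfrac12$ if $q$ is odd, $\epsilon=1$ if $q$ is even. A set of $G$-coset representatives of a $G$-invariant set $\mathcal T$ is a subset $T\subseteq\mathcal T$ containing exactly one element of each coset $G\cdot t$, $t\in\mathcal T$. (1) Let $q$ be a square, $d$ odd, and let $H(d-1,q)$ be the polar space on $V$ of the Hermitian form $\mathrm{Tr}_{q^b/q}\circ\kappa'$. Let $\mathcal T\subseteq\mathbb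 F_{q^{b/2}}^*$ be non-empty, $\mathbb F_{q^{1/2}}^*$-invariant, with $\mathrm{Tr}_{q^{b/2}/q^{1/2}}(t)=0$ for all $t\in\mathcal T$, and let $T$ be a set of $\mathbb F_{q^{1/2}}^*$-coset representatives of $\mathcal T$. If $\mathcal M=\{\langle v\rangle: H'(v)\in\mathcal T\}$ is an $m$-ovoid of $H(d-1,q)$ with $m=\frac{|T|}{q^{1/2}+1}q^{(d-b)/2}$, then $$|T|\ \ge\ \frac{q^{b/2}}{(q^{1/2}-1)(2q^{b/4}+1)}.$$ (2) Let $d/b\ge 4$ be even, let $Q'(x)=x_1x_2+\dots+x_{d/b-3}x_{d/b-2}+x_{d/b-1}^2+a_0x_{d/b-1}x_{d/b}+a_1x_{d/b}^2$ with $X^2+a_0X+a_1$ irreducible over $\mathbb F_{q^b}$, and let $Q^-(d-1,q)$ be the polar space on $V$ of the quadratic form $\mathrm{Tr}_{q^b/q}\circ Q'$. Let $\mathcal T\subseteq\mathbb F_{q^b}^*$ be non-empty, $\square$-invariant, with $\mathrm{Tr}_{q^b/q}(t)=0$ for all $t\in\mathcal T$, and let $T$ be a set of $\square$-coset representatives of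 $\mathcal T$. If $\{\langle v\rangle: Q'(v)\in\mathcal T\}$ is an $m$-ovoid of $Q^-(d-1,q)$ with $m=\epsilon|T|q^{d/2-b}$, then $$|T|\ \ge\ \frac{q^{b}}{\epsilon(q-1)(2q^{b/2}+1)}.$$ (3) Let $b$ be even, $d/b$ odd, and let $Q^-(d-1,q)$ be the polar space on $V$ of the quadratic form $\mathrm{Tr}_{q^{b/2}/q}\circ H'$. Let $\mathcal T\subseteq\mathbb F_{q^{b/2}}^*$ be non-empty, $\square$-invariant, with $\mathrm{Tr}_{q^{b/2}/q}(t)=0$ for all $t\in\mathcal T$, and let $T$ be a set of $\square$-coset representatives of $\mathcal T$. If $\{\langle v\rangle: H'(v)\in\mathcal T\}$ is an $m$-ovoid of $Q^-(d-1,q)$ with $m=\epsilon|T|q^{(d-b)/2}$, then $$|T|\ \ge\ \frac{q^{b/2}}{\epsilon(q-1)(2q^{b/4}+1)}.$$ (4) Let $b$ be even, $d/b$ odd, $\lambda\in\mathbb F_{q^b}^*$ with $\lambda+\lambda^{q^{b/2}}=0$, and let $W(d-1,q)$ be the polar space on $V$ of the symplectic form $\mathrm{Tr}_{q^b/q}\circ\lambda\kappa'$.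 Let $\mathcal T\subseteq\mathbb F_{q^{b/2}}^*$ be non-empty and $\square$-invariant, and let $T$ be a set of $\square$-coset representatives of $\mathcal T$. If $\{\langle v\rangle: H'(v)\in\mathcal T\}$ is an $m$-ovoid of $W(d-1,q)$ with $m=\epsilon|T|q^{(d-b)/2}$, then $$|T|\ \ge\ \frac{q^{b/2}}{\epsilon(q-1)(2q^{b/4}+1)}.$$ -/

import Mathlib

open Polynomial

noncomputable section

namespace PolarSpace

section Geometry

variable {K V : Type*} [Field K] [AddCommGroup V] [Module K V]

/-- Totally isotropic subspaces of `V` for a form `κ` in two variables. -/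
def TotallyIsotropic (κ : V → V → K) (W : Submodule K V) : Prop :=
  ∀ x ∈ W, ∀ y ∈ W, κ x y = 0

/-- Totally singular subspaces of `V` for a quadratic form `Q`. -/
def TotallySingular (Q : V → K) (W : Submodule K V) : Prop :=
  ∀ x ∈ W, Q x = 0

/-- The polar space is given by its totally isotropic (or totally singular) subspaces `S`.
An `m`-ovoid is a set of points of the polar space that meets each generator, that is, each
maximal totally isotropic (singular) subspace, in exactly `m` points. -/
def IsMOvoid (S : Submodule K V → Prop) (m : ℕ) (M : Set (Projectivization K V)) : Prop :=
  (∀ p ∈ M, S p.submodule) ∧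
    ∀ W : Submodule K V, Maximal S W → {p ∈ M | p.submodule ≤ W}.ncard = m

variable (K) in
/-- The set `{⟨v⟩_K : F v ∈ 𝒯}` of one-dimensional `K`-subspaces of `V`. -/
def pointsWithValueIn {E : Type*} (F : V → E) (𝒯 : Set E) : Set (Projectivization K V) :=
  {p | ∃ (v : V) (hv : v ≠ 0), F v ∈ 𝒯 ∧ p = Projectivization.mk K v hv}

end Geometry

section Cosets

variable (K : Type*) [Field K]

/-- The nonzero elements of `K`. -/
def nonzeroElements : Set K := {c | c ≠ 0}

/-- The nonzero squares of `K`. -/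
def nonzeroSquares : Set K := {c | c ≠ 0 ∧ IsSquare c}

variable {K} {E : Type*} [Field E] [Algebra K E]

/-- `𝒯` is a set of nonzero elements of `E` that is invariant under multiplication by `G ⊆ K`. -/
def IsInvariantSet (G : Set K) (𝒯 : Set E) : Prop :=
  (∀ t ∈ 𝒯, t ≠ 0) ∧ ∀ c ∈ G, ∀ t ∈ 𝒯, c • t ∈ 𝒯

/-- `T` contains exactly one element of each coset `G • t`, `t ∈ 𝒯`, and nothing else. -/
def IsCosetReps (G : Set K) (𝒯 : Set E) (T : Finset E) : Prop :=
  (∀ t ∈ T, t ∈ 𝒯) ∧ ∀ x ∈ 𝒯, ∃! t, t ∈ T ∧ ∃ c ∈ G, x = c • t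

/-- `1/2` or `1` according as `q` is odd or even. -/
def epsilon (q : ℕ) : ℝ := if Odd q then 1 / 2 else 1

end Cosets

section Hermitian

variable (L₀ : Type*) {L : Type*} [Field L₀] [Field L] [Algebra L₀ L] {n : ℕ}

/-- The Hermitian form `κ'(x, y) = ∑ xᵢ yᵢ ^ |L₀|` on `Lⁿ`, where `L / L₀` is a quadratic extension
of finite fields. -/
def hermForm (x y : Fin n → L) : L := ∑ i, x i * y i ^ Nat.card L₀

/-- The map `H'(x) = κ'(x, x)`, with values in `L₀`; see `algebraMap_hermNorm`. -/
def hermNorm (x : Fin n → L) : L₀ := ∑ i, Algebra.norm L₀ (x i)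

theorem algebraMap_hermNorm [Finite L₀] [Finite L] (h : Module.finrank L₀ L = 2)
    (x : Fin n → L) : algebraMap L₀ L (hermNorm L₀ x) = hermForm L₀ x x := by
  simp only [hermNorm, hermForm, map_sum]
  refine Finset.sum_congr rfl fun i _ => ?_
  rw [FiniteField.algebraMap_norm_eq_prod_pow, h]
  simp [Finset.prod_range_succ]

end Hermitian

/-- The quadratic form
`Q'(x) = x₁x₂ + x₃x₄ + ⋯ + x₂ₖ₋₁x₂ₖ + (x₂ₖ₊₁² + a₀ x₂ₖ₊₁ x₂ₖ₊₂ + a₁ x₂ₖ₊₂²)` on `L ^ (2k + 2)`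
(coordinates are numbered from `0` in the code). It is elliptic when `X² + a₀ X + a₁` is
irreducible. -/
def ellipticForm {L : Type*} [Field L] {k : ℕ} (a₀ a₁ : L) (x : Fin (2 * k + 2) → L) : L :=
  (∑ i : Fin k, x ⟨2 * i, by omega⟩ * x ⟨2 * i + 1, by omega⟩) +
    (x ⟨2 * k, by omega⟩ ^ 2 + a₀ * x ⟨2 * k, by omega⟩ * x ⟨2 * k + 1, by omega⟩ +
      a₁ * x ⟨2 * k + 1, by omega⟩ ^ 2)

end PolarSpace

end

/-!
Let `R` stand for `Q'` or `H'`, a form over `F` on the space `V`. It is of minus type: every Gauss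
sum `∑ x, ψ (R x)` is `-√|V|`. Let `β` be the form of the polar space, and let `D` be the set of
vectors `x` with `R x ∈ 𝒯`. If the points of `D` are an `m`-ovoid, then every generator contains the
same number `N` of vectors of `D`. Double counting passes from larger to smaller totally isotropic
subspaces, and determines how many vectors of `D` are perpendicular to a given `z ∈ D`. This gives
the Fourier coefficient `∑ x ∈ D, ψ (β x z) = N - √|V|`. Completing the square expresses the same
coefficient as `-√|V| / |F|` times a sum over `t ∈ 𝒯` of Kloosterman sums, so Weil's bound
`|K| ≤ 2 √|F|` yields `|F| ≤ |𝒯| (2 √|F| + 1)`; finally `𝒯` consists of `|T|` cosets of equal size.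

For Weil's bound, let `E / F` be the quadratic extension. A pair of elements of `F` is the pair of
trace and norm of exactly two elements of the algebras `F × F` and `E` taken together, so the
Kloosterman sum over `E` is `2 |F| - K²`. If `|K|` were larger than `2 √|F|`, the excess would grow
along a tower of quadratic extensions and contradict a bound by Stepanov's method (with an auxiliary
function in the style of Bombieri) for the points of `y ^ |F| - y = x + b / x - γ`.
-/

noncomputable section

namespace PolarSpace

open scoped Finset

section TraceChar

/-- The character `ψ ∘ Tr` of an extension `E` of `F`. -/
def traceChar {F : Type*} (E : Type*) [Field F] [Field E] [Algebra F E] (ψ : AddChar F ℂ) :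
    AddChar E ℂ := ψ.compAddMonoidHom (Algebra.trace F E).toAddMonoidHom

theorem traceChar_apply {F E : Type*} [Field F] [Field E] [Algebra F E] (ψ : AddChar F ℂ) (x : E) :
    traceChar E ψ x = ψ (Algebra.trace F E x) := rfl

theorem traceChar_ne_one {F E : Type*} [Field F] [Field E] [Algebra F E] [Finite E]
    {ψ : AddChar F ℂ} (hψ : ψ ≠ 1) : traceChar E ψ ≠ 1 := by
  have : Finite F := Finite.of_injective _ (algebraMap F E).injective
  obtain ⟨t, ht⟩ := AddChar.ne_one_iff.1 hψ
  obtain ⟨x, rfl⟩ := Algebra.trace_surjective F E t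
  exact AddChar.ne_one_iff.2 ⟨x, ht⟩

theorem traceChar_traceChar {F E L : Type*} [Field F] [Field E] [Field L] [Algebra F E]
    [Algebra E L] [Algebra F L] [IsScalarTower F E L] [Finite L] (ψ : AddChar F ℂ) :
    traceChar L (traceChar E ψ) = traceChar L ψ := by
  have : Finite E := Finite.of_injective _ (algebraMap E L).injective
  ext x
  simp [traceChar_apply, Algebra.trace_trace]

end TraceChar

section Kloosterman

variable {F : Type*} [Field F] [Fintype F]

/-- The Kloosterman sum `∑_{x ≠ 0} ψ (x + b / x)`. Fixing the coefficient of `x` to be `1` loses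
nothing, by `sum_addChar_mul_add_div`. -/
def kloostermanSum [DecidableEq F] (ψ : AddChar F ℂ) (b : F) : ℂ := ∑ x with x ≠ 0, ψ (x + b / x)

theorem sum_addChar_mul_add_div [DecidableEq F] (ψ : AddChar F ℂ) {a : F} (ha : a ≠ 0) (b : F) :
    ∑ x with x ≠ 0, ψ (a * x + b / x) = kloostermanSum ψ (a * b) := by
  refine Finset.sum_equiv (Equiv.mulLeft₀ a ha) (by simp [ha]) fun x _ => ?_
  simp [mul_div_mul_left _ _ ha]

theorem sum_addChar_mul_eq_zero {ψ : AddChar F ℂ} (hψ : ψ ≠ 1) {c : F} (hc : c ≠ 0) :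
    ∑ x, ψ (x * c) = 0 := by
  classical
  simpa [hc] using AddChar.sum_mulShift c (AddChar.IsPrimitive.of_ne_one hψ)

theorem eq_and_eq_or_eq_and_eq_of_add_eq_of_mul_eq {R : Type*} [CommRing R] [IsDomain R]
    {u v w z : R} (hadd : u + v = w + z) (hmul : u * v = w * z) :
    u = w ∧ v = z ∨ u = z ∧ v = w := by
  have hfactor : (u - w) * (u - z) = 0 := by linear_combination u * hadd - hmul
  rcases mul_eq_zero.1 hfactor with h | h
  · exact .inl ⟨sub_eq_zero.1 h, by linear_combination hadd - h⟩
  · exact .inr ⟨sub_eq_zero.1 h, by linear_combination hadd - h⟩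

variable {E : Type*} [Field E] [Algebra F E]

section

variable [Finite E]

theorem algebraMap_trace_of_finrank_two (h : Module.finrank F E = 2) (x : E) :
    algebraMap F E (Algebra.trace F E x) = x + x ^ Fintype.card F := by
  simp [FiniteField.algebraMap_trace_eq_sum_pow, h, Finset.sum_range_succ]

theorem algebraMap_norm_of_finrank_two (h : Module.finrank F E = 2) (x : E) :
    algebraMap F E (Algebra.norm F x) = x * x ^ Fintype.card F := by
  simp [FiniteField.algebraMap_norm_eq_prod_pow, h, Finset.prod_range_succ]

omit [Fintype F] in
theorem trace_inv_of_finrank_two (h : Module.finrank F E = 2) {x : E} (hx : x ≠ 0) :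
    Algebra.trace F E x⁻¹ = Algebra.trace F E x / Algebra.norm F x := by
  have : Finite F := Finite.of_injective _ (algebraMap F E).injective
  cases nonempty_fintype F
  apply (algebraMap F E).injective
  rw [map_div₀, algebraMap_trace_of_finrank_two h, algebraMap_trace_of_finrank_two h,
    algebraMap_norm_of_finrank_two h, inv_pow]
  have hpow : x ^ Fintype.card F ≠ 0 := pow_ne_zero _ hx
  field_simp
  ring

theorem trace_norm_eq_iff_of_finrank_two (h : Module.finrank F E = 2) (x y : E) :
    (Algebra.trace F E y, Algebra.norm F y) = (Algebra.trace F E x, Algebra.norm F x) ↔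
      y = x ∨ y = x ^ Fintype.card F := by
  simp only [Prod.mk.injEq, ← (algebraMap F E).injective.eq_iff,
    algebraMap_trace_of_finrank_two h, algebraMap_norm_of_finrank_two h]
  refine ⟨fun ⟨hadd, hmul⟩ =>
    (eq_and_eq_or_eq_and_eq_of_add_eq_of_mul_eq hadd hmul).imp And.left And.left, ?_⟩
  rintro (rfl | rfl)
  · simp
  · cases nonempty_fintype E
    have hx : (x ^ Fintype.card F) ^ Fintype.card F = x := by
      rw [← pow_mul, ← sq, ← h, ← Module.card_eq_pow_finrank, FiniteField.pow_card]
    rw [hx]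
    exact ⟨add_comm _ _, mul_comm _ _⟩

theorem pow_card_eq_self_and_fst_eq_snd_of_trace_norm_eq (h : Module.finrank F E = 2) {x : E}
    {u : F × F} (hxu : (Algebra.trace F E x, Algebra.norm F x) = (u.1 + u.2, u.1 * u.2)) :
    x ^ Fintype.card F = x ∧ u.1 = u.2 := by
  simp only [Prod.mk.injEq, ← (algebraMap F E).injective.eq_iff, algebraMap_trace_of_finrank_two h,
    algebraMap_norm_of_finrank_two h, map_add, map_mul] at hxu
  have hfix (c : F) : algebraMap F E c ^ Fintype.card F = algebraMap F E c := by
    rw [← map_pow, FiniteField.pow_card]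
  rcases eq_and_eq_or_eq_and_eq_of_add_eq_of_mul_eq hxu.1 hxu.2 with ⟨h₁, h₂⟩ | ⟨h₁, h₂⟩ <;>
  · rw [h₁, hfix] at h₂
    exact ⟨by rw [h₁, hfix], (algebraMap F E).injective (by simp [h₂])⟩

end

omit [Fintype F] in
theorem add_mul_eq_iff (u v : F × F) :
    (v.1 + v.2, v.1 * v.2) = (u.1 + u.2, u.1 * u.2) ↔ v = u ∨ v = u.swap := by
  simp only [Prod.ext_iff, Prod.fst_swap, Prod.snd_swap]
  refine ⟨fun ⟨hadd, hmul⟩ => eq_and_eq_or_eq_and_eq_of_add_eq_of_mul_eq hadd hmul, ?_⟩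
  rintro (⟨h₁, h₂⟩ | ⟨h₁, h₂⟩) <;> simp [h₁, h₂, add_comm, mul_comm]

variable [Fintype E] [DecidableEq F]

theorem card_add_mul_add_card_trace_norm_le (h : Module.finrank F E = 2) (p : F × F) :
    #{u : F × F | (u.1 + u.2, u.1 * u.2) = p} +
      #{x : E | (Algebra.trace F E x, Algebra.norm F x) = p} ≤ 2 := by
  classical
  have hsplit (u : F × F) (hu : (u.1 + u.2, u.1 * u.2) = p) :
      #{u : F × F | (u.1 + u.2, u.1 * u.2) = p} = #{u, u.swap} := by
    simp only [← hu, add_mul_eq_iff]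
    congr 1
    ext; simp
  have hfield (x : E) (hx : (Algebra.trace F E x, Algebra.norm F x) = p) :
      #{x : E | (Algebra.trace F E x, Algebra.norm F x) = p} = #{x, x ^ Fintype.card F} := by
    simp only [← hx, trace_norm_eq_iff_of_finrank_two h]
    congr 1
    ext; simp
  rcases Finset.eq_empty_or_nonempty {u : F × F | (u.1 + u.2, u.1 * u.2) = p} with hu | ⟨u, hu⟩
  · rcases Finset.eq_empty_or_nonempty
      {x : E | (Algebra.trace F E x, Algebra.norm F x) = p} with hx | ⟨x, hx⟩
    · simp [hu, hx]
    · simpa [hu, hfield x (by simpa using hx)] using Finset.card_le_two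
  rcases Finset.eq_empty_or_nonempty
    {x : E | (Algebra.trace F E x, Algebra.norm F x) = p} with hx | ⟨x, hx⟩
  · simpa [hx, hsplit u (by simpa using hu)] using Finset.card_le_two
  replace hu : (u.1 + u.2, u.1 * u.2) = p := by simpa using hu
  replace hx : (Algebra.trace F E x, Algebra.norm F x) = p := by simpa using hx
  obtain ⟨hxF, huF⟩ := pow_card_eq_self_and_fst_eq_snd_of_trace_norm_eq h (hx.trans hu.symm)
  have hswap : u.swap = u := Prod.ext huF.symm huF
  simp [hsplit u hu, hfield x hx, hxF, hswap]

theorem card_add_mul_add_card_trace_norm (h : Module.finrank F E = 2) (p : F × F) :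
    #{u : F × F | (u.1 + u.2, u.1 * u.2) = p} +
      #{x : E | (Algebra.trace F E x, Algebra.norm F x) = p} = 2 := by
  have htotal : ∑ p : F × F, (#{u : F × F | (u.1 + u.2, u.1 * u.2) = p} +
      #{x : E | (Algebra.trace F E x, Algebra.norm F x) = p}) = ∑ p : F × F, 2 := by
    rw [Finset.sum_add_distrib, ← Finset.card_eq_sum_card_fiberwise (fun _ _ => by simp),
      ← Finset.card_eq_sum_card_fiberwise (fun _ _ => by simp)]
    simp only [Finset.card_univ, Fintype.card_prod, Finset.sum_const, smul_eq_mul,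
      Module.card_eq_pow_finrank (K := F) (V := E), h]
    ring
  exact (Finset.sum_eq_sum_iff_of_le fun p _ => card_add_mul_add_card_trace_norm_le h p).1 htotal p
    (Finset.mem_univ p)

omit [DecidableEq F] in
theorem sum_add_mul_add_sum_trace_norm (h : Module.finrank F E = 2) (G : F × F → ℂ) :
    ∑ u : F × F, G (u.1 + u.2, u.1 * u.2) +
      ∑ x : E, G (Algebra.trace F E x, Algebra.norm F x) = 2 * ∑ p, G p := by
  classical
  rw [← Finset.sum_fiberwise' Finset.univ (fun u : F × F => (u.1 + u.2, u.1 * u.2)),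
    ← Finset.sum_fiberwise' Finset.univ (fun x : E => (Algebra.trace F E x, Algebra.norm F x)),
    ← Finset.sum_add_distrib, Finset.mul_sum]
  refine Finset.sum_congr rfl fun p _ => ?_
  simp only [Finset.sum_const, nsmul_eq_mul, ← add_mul, ← Nat.cast_add,
    card_add_mul_add_card_trace_norm h, Nat.cast_ofNat]

theorem sum_addChar_add_mul_inv {ψ : AddChar F ℂ} (hψ : ψ ≠ 1) {b : F} (hb : b ≠ 0) :
    ∑ p : F × F, (if p.2 = 0 then 0 else ψ (p.1 * (1 + b / p.2))) = Fintype.card F := by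
  rw [Fintype.sum_prod_type_right, Fintype.sum_eq_single (-b)]
  · simp [hb]
  · intro ν hν
    by_cases hν₀ : ν = 0
    · simp [hν₀]
    have hne : 1 + b / ν ≠ 0 := by
      intro h
      field_simp at h
      exact hν (by linear_combination h)
    simp only [hν₀, if_false, sum_addChar_mul_eq_zero hψ hne]

theorem kloostermanSum_of_finrank_two [DecidableEq E] (h : Module.finrank F E = 2)
    {ψ : AddChar F ℂ} (hψ : ψ ≠ 1) {b : F} (hb : b ≠ 0) :
    kloostermanSum (traceChar E ψ) (algebraMap F E b) =
      2 * Fintype.card F - kloostermanSum ψ b ^ 2 := by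
  set G : F × F → ℂ := fun p => if p.2 = 0 then 0 else ψ (p.1 * (1 + b / p.2)) with hG
  have hsplit : ∑ u : F × F, G (u.1 + u.2, u.1 * u.2) = kloostermanSum ψ b ^ 2 := by
    simp_rw [sq, kloostermanSum, Finset.sum_filter, Fintype.sum_mul_sum, Fintype.sum_prod_type]
    refine Finset.sum_congr rfl fun x _ => Finset.sum_congr rfl fun y _ => ?_
    by_cases hx : x = 0
    · simp [hx, hG]
    by_cases hy : y = 0
    · simp [hy, hG]
    simp only [hG, mul_eq_zero, hx, hy, or_self, if_false, ne_eq, not_false_eq_true, if_true,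
      ← AddChar.map_add_eq_mul]
    congr 1
    field_simp
    ring
  have hfield : ∑ x : E, G (Algebra.trace F E x, Algebra.norm F x) =
      kloostermanSum (traceChar E ψ) (algebraMap F E b) := by
    rw [kloostermanSum, Finset.sum_filter]
    refine Finset.sum_congr rfl fun x _ => ?_
    by_cases hx : x = 0
    · simp [hx, hG, Algebra.norm_zero]
    have hnorm : Algebra.norm F x ≠ 0 := Algebra.norm_ne_zero_iff.2 hx
    simp only [hG, hnorm, if_false, ne_eq, hx, not_false_eq_true, if_true, div_eq_mul_inv,
      traceChar_apply, map_add, ← Algebra.smul_def, map_smul, smul_eq_mul,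
      trace_inv_of_finrank_two h hx]
    congr 1
    ring
  have htotal := sum_add_mul_add_sum_trace_norm (E := E) h G
  rw [hsplit, hfield, hG, sum_addChar_add_mul_inv hψ hb] at htotal
  linear_combination htotal

end Kloosterman

section BoxSpan

variable (k : Type*) {A : Type*} [Field k] [CommRing A] [Algebra k A] (x y : A) (Q : ℕ)

/-- The map sending polynomials `p_f` of degree `< N` to `∑_{f < Q} p_f(x) y ^ f`. -/
def boxMap (N : ℕ) : (Fin Q → degreeLT k N) →ₗ[k] A :=
  ∑ f : Fin Q, LinearMap.mulRight k (y ^ (f : ℕ)) ∘ₗ (aeval x).toLinearMap ∘ₗ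
    (degreeLT k N).subtype ∘ₗ LinearMap.proj f

/-- The space of all `∑_{f < Q} p_f(x) y ^ f` with polynomials `p_f` of degree `< N`. It bounds the
poles at the places above `x = ∞` and `y = ∞` of functions on a curve with coordinates `x` and `y`
on which `y` has degree `Q`. -/
def boxSpan (N : ℕ) : Submodule k A := LinearMap.range (boxMap k x y Q N)

instance (N : ℕ) : Module.Finite k (boxSpan k x y Q N) :=
  have : Module.Finite k (degreeLT k N) := .equiv (degreeLTEquiv k N).symm
  Module.Finite.range (boxMap k x y Q N)

theorem finrank_boxSpan_le (N : ℕ) : Module.finrank k (boxSpan k x y Q N) ≤ Q * N := by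
  have : Module.Finite k (degreeLT k N) := .equiv (degreeLTEquiv k N).symm
  refine (LinearMap.finrank_range_le _).trans_eq ?_
  simp [Module.finrank_pi_fintype, (degreeLTEquiv k N).finrank_eq]

variable {k x y Q}

theorem mem_boxSpan {N : ℕ} {w : A} : w ∈ boxSpan k x y Q N ↔
    ∃ p : Fin Q → k[X], (∀ f, (p f).degree < N) ∧ ∑ f, aeval x (p f) * y ^ (f : ℕ) = w := by
  constructor
  · rintro ⟨p, rfl⟩
    exact ⟨fun f => p f, fun f => mem_degreeLT.1 (p f).2, by simp [boxMap]⟩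
  · rintro ⟨p, hp, rfl⟩
    exact ⟨fun f => ⟨p f, mem_degreeLT.2 (hp f)⟩, by simp [boxMap]⟩

theorem aeval_mul_pow_mem_boxSpan {N f : ℕ} (hf : f < Q) {p : k[X]} (hp : p.degree < N) :
    aeval x p * y ^ f ∈ boxSpan k x y Q N := by
  classical
  refine mem_boxSpan.2 ⟨Pi.single ⟨f, hf⟩ p, fun g => ?_, ?_⟩
  · rcases eq_or_ne g ⟨f, hf⟩ with rfl | hg
    · simpa using hp
    · simp [hg]
  · rw [Fintype.sum_eq_single ⟨f, hf⟩ fun g hg => by simp [hg]]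
    simp

theorem boxSpan_le {N : ℕ} {W : Submodule k A}
    (h : ∀ f < Q, ∀ p : k[X], p.degree < N → aeval x p * y ^ f ∈ W) : boxSpan k x y Q N ≤ W := by
  intro w hw
  obtain ⟨p, hp, rfl⟩ := mem_boxSpan.1 hw
  exact sum_mem fun f _ => h f f.2 (p f) (hp f)

theorem boxSpan_mono {N N' : ℕ} (h : N ≤ N') : boxSpan k x y Q N ≤ boxSpan k x y Q N' :=
  boxSpan_le fun _ hf _ hp => aeval_mul_pow_mem_boxSpan hf (hp.trans_le (by exact_mod_cast h))

theorem degree_mul_lt_add {p q : k[X]} {m n : ℕ} (hp : p.natDegree ≤ m) (hq : q.degree < n) :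
    (p * q).degree < (m + n : ℕ) := by
  rcases eq_or_ne q 0 with rfl | _
  · simp
  calc (p * q).degree ≤ p.degree + q.degree := degree_mul_le _ _
    _ ≤ m + q.degree := by gcongr; exact natDegree_le_iff_degree_le.1 hp
    _ < m + n := WithBot.add_lt_add_left (by simp) hq
    _ = (m + n : ℕ) := by simp

theorem aeval_mul_mem_boxSpan {m N : ℕ} {p : k[X]} (hp : p.natDegree ≤ m) {w : A}
    (hw : w ∈ boxSpan k x y Q N) : aeval x p * w ∈ boxSpan k x y Q (m + N) := by
  suffices h : boxSpan k x y Q N ≤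
      (boxSpan k x y Q (m + N)).comap (LinearMap.mulLeft k (aeval x p)) from h hw
  refine boxSpan_le fun f hf q hq => ?_
  rw [Submodule.mem_comap, LinearMap.mulLeft_apply, ← mul_assoc, ← map_mul]
  exact aeval_mul_pow_mem_boxSpan hf (degree_mul_lt_add hp hq)

theorem pow_mul_mem_boxSpan (m : ℕ) {N : ℕ} {w : A} (hw : w ∈ boxSpan k x y Q N) :
    x ^ m * w ∈ boxSpan k x y Q (m + N) := by
  simpa using aeval_mul_mem_boxSpan (natDegree_X_pow_le (R := k) m) hw

variable {q : k[X]} (hq : q.natDegree ≤ 2) (hcurve : x * y ^ Q = x * y + aeval x q)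
include hq hcurve

theorem mul_mul_mem_boxSpan (hQ : 1 < Q) {N : ℕ} {w : A} (hw : w ∈ boxSpan k x y Q N) :
    x * y * w ∈ boxSpan k x y Q (2 + N) := by
  suffices h : boxSpan k x y Q N ≤
      (boxSpan k x y Q (2 + N)).comap (LinearMap.mulLeft k (x * y)) from h hw
  refine boxSpan_le fun f hf p hp => ?_
  rw [Submodule.mem_comap, LinearMap.mulLeft_apply]
  have hX : (X * p : k[X]).degree < (2 + N : ℕ) :=
    degree_mul_lt_add (natDegree_X_le.trans one_le_two) hp
  by_cases hf' : f + 1 < Q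
  · rw [show x * y * (aeval x p * y ^ f) = aeval x (X * p) * y ^ (f + 1) by simp; ring]
    exact aeval_mul_pow_mem_boxSpan hf' hX
  · have hexpand : x * y * (aeval x p * y ^ f) =
        aeval x (X * p) * y ^ 1 + aeval x (q * p) * y ^ 0 := by
      have hfQ : Q = f + 1 := by omega
      rw [hfQ] at hcurve
      simp only [map_mul, aeval_X]
      linear_combination aeval x p * hcurve
    rw [hexpand]
    exact add_mem (aeval_mul_pow_mem_boxSpan hQ hX)
      (aeval_mul_pow_mem_boxSpan (by omega) (degree_mul_lt_add hq hp))

end BoxSpan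

section Frobenius

variable (F : Type*) {k A : Type*} [Field F] [Fintype F] [Field k] [CommRing A] [Algebra k A]
  [Algebra F A] {x y : A} {q : k[X]}

theorem pow_card_pow_sum (M : ℕ) {ι : Type*} (s : Finset ι) (u : ι → A) :
    (∑ i ∈ s, u i) ^ Fintype.card F ^ M = ∑ i ∈ s, u i ^ Fintype.card F ^ M := by
  induction M with
  | zero => simp
  | succ M ih =>
    simp_rw [pow_succ, pow_mul, ih]
    exact map_sum (FiniteField.frobeniusAlgHom F A) _ s

theorem exists_pow_mul_pow_card_pow_eq_add (hq : q.natDegree ≤ 2)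
    (hcurve : x * y ^ Fintype.card F = x * y + aeval x q) (M : ℕ) :
    ∃ h : k[X], h.natDegree ≤ 2 * Fintype.card F ^ M ∧
      x ^ Fintype.card F ^ M * y ^ Fintype.card F ^ (M + 1) =
        x ^ Fintype.card F ^ M * y + aeval x h := by
  induction M with
  | zero => exact ⟨q, by simpa using hq, by simpa using hcurve⟩
  | succ M ih =>
    obtain ⟨h, hdeg, heq⟩ := ih
    obtain ⟨s, hs⟩ := Nat.exists_eq_add_one_of_ne_zero
      (pow_ne_zero (M + 1) (Fintype.card_ne_zero (α := F)))
    refine ⟨X ^ s * q + h ^ Fintype.card F, ?_, ?_⟩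
    · refine natDegree_add_le_of_degree_le (natDegree_mul_le.trans ?_)
        (natDegree_pow_le_of_le _ hdeg |>.trans_eq (by ring))
      rw [natDegree_X_pow]
      omega
    · have hfrob := congrArg (FiniteField.frobeniusAlgHom F A) heq
      rw [map_add, map_mul] at hfrob
      simp only [FiniteField.frobeniusAlgHom_apply, mul_pow, ← pow_mul, ← pow_succ] at hfrob
      rw [hfrob, map_add, map_mul, map_pow, map_pow, aeval_X, hs, pow_succ]
      linear_combination x ^ s * hcurve

variable (hq : q.natDegree ≤ 2) (hcurve : x * y ^ Fintype.card F = x * y + aeval x q)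
include hq hcurve

theorem pow_mul_pow_mul_mem_boxSpan (M f : ℕ) {N : ℕ} {w : A}
    (hw : w ∈ boxSpan k x y (Fintype.card F) N) :
    (x ^ Fintype.card F ^ M * y ^ Fintype.card F ^ (M + 1)) ^ f * w ∈
      boxSpan k x y (Fintype.card F) (2 * Fintype.card F ^ M * f + N) := by
  obtain ⟨h, hdeg, heq⟩ := exists_pow_mul_pow_card_pow_eq_add F hq hcurve M
  obtain ⟨s, hs⟩ := Nat.exists_eq_add_one_of_ne_zero
    (pow_ne_zero M (Fintype.card_ne_zero (α := F)))
  rw [heq, hs]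
  rw [hs] at hdeg
  induction f with
  | zero => simpa using hw
  | succ f ih =>
    rw [show (x ^ (s + 1) * y + aeval x h) ^ (f + 1) * w =
      x ^ s * (x * y * ((x ^ (s + 1) * y + aeval x h) ^ f * w)) +
        aeval x h * ((x ^ (s + 1) * y + aeval x h) ^ f * w) by ring]
    refine add_mem (boxSpan_mono (by ring_nf; omega) <| pow_mul_mem_boxSpan s <|
      mul_mul_mem_boxSpan hq hcurve Fintype.one_lt_card ih)
      (boxSpan_mono (by ring_nf; omega) (aeval_mul_mem_boxSpan hdeg ih))

end Frobenius

section DigitMonomial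

variable (F : Type*) {k A : Type*} [Field F] [Fintype F] [Field k] [CommRing A] [Algebra k A]
  {x y : A} {q : k[X]}

variable (x y) in
/-- The monomial `x ^ e * y ^ f` with `n = Q e + f` and `f < Q`. -/
def digitMonomial (Q n : ℕ) : A := x ^ (n / Q) * y ^ (n % Q)

theorem digitMonomial_mem_boxSpan {Q n E : ℕ} (hQ : 0 < Q) (hn : n < Q * E) :
    digitMonomial x y Q n ∈ boxSpan k x y Q E := by
  have hdeg : (X ^ (n / Q) : k[X]).degree < E := by
    rw [degree_X_pow]
    exact_mod_cast Nat.div_lt_of_lt_mul hn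
  simpa [digitMonomial] using aeval_mul_pow_mem_boxSpan (x := x) (y := y) (Nat.mod_lt n hQ) hdeg

variable [Algebra F A] (hq : q.natDegree ≤ 2)
  (hcurve : x * y ^ Fintype.card F = x * y + aeval x q)
include hq hcurve

theorem pow_mul_digitMonomial_mem_boxSpan (M : ℕ) {m n E E' : ℕ}
    (hm : m < Fintype.card F * E') (hn : n < Fintype.card F * E) :
    x ^ Fintype.card F ^ (M + 1) * (digitMonomial x y (Fintype.card F) m ^ Fintype.card F ^ (M + 1)
      * digitMonomial x y (Fintype.card F) n) ∈
      boxSpan k x y (Fintype.card F) ((E' + 1) * Fintype.card F ^ (M + 1) + E) := by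
  obtain ⟨e, f, hef⟩ : ∃ e f, e = m / Fintype.card F ∧ f = m % Fintype.card F := ⟨_, _, rfl, rfl⟩
  have hf : Fintype.card F ^ M * f + Fintype.card F ^ M ≤ Fintype.card F ^ (M + 1) := by
    rw [pow_succ, ← Nat.mul_succ, hef.2]
    exact Nat.mul_le_mul_left _ (Nat.mod_lt m Fintype.card_pos)
  have he : e * Fintype.card F ^ (M + 1) + Fintype.card F ^ (M + 1) ≤
      E' * Fintype.card F ^ (M + 1) := by
    rw [← Nat.succ_mul, hef.1]
    exact Nat.mul_le_mul_right _ (Nat.div_lt_of_lt_mul hm)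
  obtain ⟨r, hr⟩ := Nat.exists_eq_add_of_le (le_of_add_le_left hf)
  have hxR : x ^ Fintype.card F ^ (M + 1) = (x ^ Fintype.card F ^ M) ^ f * x ^ r := by
    rw [← pow_mul, ← pow_add, ← hr]
  have hexpand : x ^ Fintype.card F ^ (M + 1) * (digitMonomial x y (Fintype.card F) m ^
      Fintype.card F ^ (M + 1) * digitMonomial x y (Fintype.card F) n) =
      x ^ (e * Fintype.card F ^ (M + 1) + r) *
        ((x ^ Fintype.card F ^ M * y ^ Fintype.card F ^ (M + 1)) ^ f *
          digitMonomial x y (Fintype.card F) n) := by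
    rw [digitMonomial, ← hef.1, ← hef.2, hxR, pow_add, pow_mul, mul_pow, mul_pow,
      pow_right_comm y]
    ring
  rw [hexpand]
  exact boxSpan_mono (by linarith) <| pow_mul_mem_boxSpan _ <|
    pow_mul_pow_mul_mem_boxSpan F hq hcurve M f (digitMonomial_mem_boxSpan Fintype.card_pos hn)

theorem exists_sum_digitMonomial_eq_zero (M : ℕ) :
    ∃ c : Fin (Fintype.card F ^ (M + 1)) × Fin (Fintype.card F * (Fintype.card F ^ M + 4)) → k,
      x ^ Fintype.card F ^ (M + 1) * ∑ i, c i • (digitMonomial x y (Fintype.card F) i.1 ^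
          Fintype.card F ^ (M + 1) * digitMonomial x y (Fintype.card F) i.2) = 0 ∧
        ∃ i, c i ≠ 0 := by
  have hR : Fintype.card F ^ (M + 1) = Fintype.card F * Fintype.card F ^ M := pow_succ' _ M
  let v (i : Fin (Fintype.card F ^ (M + 1)) × Fin (Fintype.card F * (Fintype.card F ^ M + 4))) :
      boxSpan k x y (Fintype.card F)
        ((Fintype.card F ^ M + 1) * Fintype.card F ^ (M + 1) + (Fintype.card F ^ M + 4)) :=
    ⟨_, pow_mul_digitMonomial_mem_boxSpan F hq hcurve M (i.1.2.trans_eq hR) i.2.2⟩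
  have hdep : ¬ LinearIndependent k v := fun hli => by
    have hcard := hli.fintype_card_le_finrank.trans (finrank_boxSpan_le k x y _ _)
    rw [Fintype.card_prod, Fintype.card_fin, Fintype.card_fin, mul_left_comm] at hcard
    have hcard' := Nat.le_of_mul_le_mul_left hcard Fintype.card_pos
    have hs : 0 < Fintype.card F ^ M := pow_pos Fintype.card_pos M
    have hQ : 1 < Fintype.card F := Fintype.one_lt_card
    rw [hR] at hcard'
    nlinarith
  obtain ⟨c, hc, hne⟩ := Fintype.not_linearIndependent_iff.1 hdep
  refine ⟨c, ?_, hne⟩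
  have hsum := congrArg (Submodule.subtype _) hc
  simpa [v, Finset.mul_sum] using hsum

theorem mul_sum_digitMonomial_mem_boxSpan (M : ℕ)
    (c : Fin (Fintype.card F ^ (M + 1)) × Fin (Fintype.card F * (Fintype.card F ^ M + 4)) → k) :
    x ^ Fintype.card F ^ (M + 1) * ∑ i, c i • (digitMonomial x y (Fintype.card F) i.1 *
        digitMonomial x y (Fintype.card F) i.2 ^ Fintype.card F ^ (M + 1)) ∈
      boxSpan k x y (Fintype.card F)
        (Fintype.card F ^ M * Fintype.card F ^ (M + 1) + 6 * Fintype.card F ^ (M + 1)) := by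
  rw [Finset.mul_sum]
  refine sum_mem fun i _ => ?_
  rw [mul_smul_comm, mul_comm (digitMonomial x y _ i.1)]
  refine Submodule.smul_mem _ _ (boxSpan_mono ?_ (pow_mul_digitMonomial_mem_boxSpan F hq hcurve M
    i.2.2 (i.1.2.trans_eq (pow_succ' _ M))))
  have hle : Fintype.card F ^ M ≤ Fintype.card F ^ (M + 1) :=
    Nat.pow_le_pow_right Fintype.card_pos M.le_succ
  linarith

end DigitMonomial

section Stepanov

variable (F : Type*) {k A : Type*} [Field F] [Fintype F] [Field k] [CommRing A] [Algebra k A]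
  [Algebra F k] {x y : A}

theorem map_mul_sum_eq_zero_of_card_eq_sq [Fintype k] {M : ℕ}
    (hk : Fintype.card k = (Fintype.card F ^ M) ^ 2) {ι : Type*} [Fintype ι] {z : A}
    {u v : ι → A} {c : ι → k}
    (h : z * ∑ i, c i • (u i ^ Fintype.card F ^ M * v i) = 0) (φ : A →ₐ[k] k) :
    φ (z * ∑ i, c i ^ Fintype.card F ^ M • (u i * v i ^ Fintype.card F ^ M)) = 0 := by
  have hpow (t : k) : (t ^ Fintype.card F ^ M) ^ Fintype.card F ^ M = t := by
    rw [← pow_mul, ← sq, ← hk, FiniteField.pow_card]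
  have hfrob : φ (∑ i, c i ^ Fintype.card F ^ M • (u i * v i ^ Fintype.card F ^ M)) ^
      Fintype.card F ^ M = φ (∑ i, c i • (u i ^ Fintype.card F ^ M * v i)) := by
    simp only [map_sum, map_smul, map_mul, map_pow, smul_eq_mul, pow_card_pow_sum F, mul_pow, hpow]
  rw [map_mul]
  rcases mul_eq_zero.1 ((map_mul φ _ _).symm.trans ((congrArg φ h).trans (map_zero φ))) with hz | hs
  · rw [hz, zero_mul]
  · rw [eq_zero_of_pow_eq_zero (hfrob.trans hs), mul_zero]

theorem eq_zero_of_mem_boxSpan_of_forall_exists_algHom {N : ℕ} {w : A}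
    (hw : w ∈ boxSpan k x y (Fintype.card F) N) {s : Finset k} (hs : N ≤ #s)
    (hroot : ∀ x₀ ∈ s, ∃ y₀ : k, ∀ t : F, ∃ φ : A →ₐ[k] k,
      φ x = x₀ ∧ φ y = y₀ + algebraMap F k t ∧ φ w = 0) : w = 0 := by
  obtain ⟨p, hp, rfl⟩ := mem_boxSpan.1 hw
  have heval (x₀ : k) (hx₀ : x₀ ∈ s) (f : Fin (Fintype.card F)) : (p f).eval x₀ = 0 := by
    obtain ⟨y₀, hy₀⟩ := hroot x₀ hx₀
    let root (j : Fin (Fintype.card F)) : k := y₀ + algebraMap F k ((Fintype.equivFin F).symm j)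
    have hinj : Function.Injective root := fun i j hij =>
      (Fintype.equivFin F).symm.injective ((algebraMap F k).injective (add_left_cancel hij))
    refine congrFun (Matrix.eq_zero_of_forall_index_sum_mul_pow_eq_zero
      (v := fun f => (p f).eval x₀) hinj fun j => ?_) f
    obtain ⟨φ, hφx, hφy, hφ⟩ := hy₀ ((Fintype.equivFin F).symm j)
    simpa [root, ← aeval_algHom_apply, hφx, hφy] using hφ
  refine Finset.sum_eq_zero fun f _ => ?_
  have hdeg : (p f).degree < #s := (hp f).trans_le (by exact_mod_cast hs)
  rw [eq_zero_of_degree_lt_of_eval_finset_eq_zero s hdeg fun x₀ hx₀ => heval x₀ hx₀ f, map_zero,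
    zero_mul]

end Stepanov

section CurveRing

open QuadraticAlgebra

variable {k : Type*} [Field k]

theorem degree_im_omega_pow {a τ : k[X]} {Q : ℕ} (hQ : 0 < Q) (ha : a.degree ≤ Q)
    (hτ : τ.degree = Q) (e : ℕ) :
    ((ω : QuadraticAlgebra k[X] a τ) ^ (e + 1)).im.degree = (Q * e : ℕ) := by
  suffices h : ((ω : QuadraticAlgebra k[X] a τ) ^ e).im.degree < (Q * e : ℕ) ∧
      ((ω : QuadraticAlgebra k[X] a τ) ^ (e + 1)).im.degree = (Q * e : ℕ) from h.2
  induction e with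
  | zero => simp [im_one]
  | succ e ih =>
    have hlead : (τ * ((ω : QuadraticAlgebra k[X] a τ) ^ (e + 1)).im).degree =
        (Q * (e + 1) : ℕ) := by
      rw [degree_mul, hτ, ih.2, ← Nat.cast_add]
      congr 1
      ring
    have hlower : (a * ((ω : QuadraticAlgebra k[X] a τ) ^ e).im).degree < (Q * (e + 1) : ℕ) := by
      rw [mul_add_one, add_comm]
      exact degree_mul_lt_add (natDegree_le_iff_degree_le.2 ha) ih.1
    refine ⟨ih.2.trans_lt (by exact_mod_cast Nat.mul_lt_mul_of_pos_left e.lt_succ_self hQ), ?_⟩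
    have hrec : ((ω : QuadraticAlgebra k[X] a τ) ^ (e + 1 + 1)).im =
        τ * ((ω : QuadraticAlgebra k[X] a τ) ^ (e + 1)).im +
          a * ((ω : QuadraticAlgebra k[X] a τ) ^ e).im := by
      rw [pow_succ' _ (e + 1), pow_succ' _ e]
      simp only [im_mul, re_mul, omega_re, omega_im]
      ring
    rw [hrec, degree_add_eq_left_of_degree_lt (hlower.trans_eq hlead.symm), hlead]

theorem sum_smul_omega_pow_mul_pow_ne_zero {a τ : k[X]} {Q : ℕ} (hQ : 0 < Q)
    (ha : a.degree ≤ Q) (hτ : τ.degree = Q) {ι : Type*} [Fintype ι] {e f : ι → ℕ}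
    (hinj : Function.Injective fun i => Q * e i + f i) {d : ι → k} (hd : ∃ i, d i ≠ 0) :
    ∑ i, d i • ((ω : QuadraticAlgebra k[X] a τ) ^ e i * algebraMap k[X] _ X ^ f i) ≠ 0 := by
  intro hsum
  let p (i : ι) : k[X] := C (d i) * ((ω : QuadraticAlgebra k[X] a τ) ^ (e i + 1)).im * X ^ f i
  have hdeg (i : ι) (hi : d i ≠ 0) : (p i).degree = (Q * e i + f i : ℕ) := by
    rw [degree_mul, degree_C_mul hi, degree_im_omega_pow hQ ha hτ, degree_X_pow, Nat.cast_add]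
  have hp : ∑ i, p i = 0 := by
    have him := congrArg (imₗ (R := k[X]) a τ) (congrArg (ω * ·) hsum)
    simp only [Finset.mul_sum, map_sum, mul_zero, map_zero] at him
    refine (Finset.sum_congr rfl fun i _ => ?_).trans him
    rw [mul_smul_comm, ← mul_assoc, ← pow_succ', ← map_pow, QuadraticAlgebra.algebraMap_eq]
    simp [p, imₗ, im_mul, smul_eq_C_mul, mul_assoc]
  have hdisj : Set.Pairwise {i | i ∈ Finset.univ ∧ p i ≠ 0} (Function.onFun Ne (degree ∘ p)) := by
    intro i hi j hj hij heq
    have hne (l : ι) (hl : p l ≠ 0) : d l ≠ 0 := fun h => hl (by simp [p, h])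
    simp only [Function.comp_apply] at heq
    rw [hdeg i (hne i hi.2), hdeg j (hne j hj.2)] at heq
    exact hij (hinj (by exact_mod_cast heq))
  obtain ⟨i, hi⟩ := hd
  have hbot := (Finset.sup_eq_bot_iff _ _).1
    ((degree_sum_eq_of_disjoint p _ hdisj).symm.trans (by rw [hp, degree_zero])) i
      (Finset.mem_univ i)
  rw [hdeg i hi] at hbot
  exact WithBot.natCast_ne_bot _ hbot

theorem omega_pow_mul_sum_smul_digitMonomial_ne_zero {a τ : k[X]} {Q : ℕ} (hQ : 0 < Q)
    (ha : a.degree ≤ Q) (hτ : τ.degree = Q) (n : ℕ) {R S : ℕ} {d : Fin R × Fin S → k}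
    (hd : ∃ i, d i ≠ 0) :
    (ω : QuadraticAlgebra k[X] a τ) ^ n * ∑ i, d i • (digitMonomial ω (algebraMap k[X] _ X) Q i.1 *
      digitMonomial ω (algebraMap k[X] _ X) Q i.2 ^ R) ≠ 0 := by
  have hdigit (i : Fin R × Fin S) :
      Q * (n + (i.1 / Q + i.2 / Q * R)) + (i.1 % Q + i.2 % Q * R) = Q * n + (i.1 + R * i.2) := by
    conv_rhs => rw [← Nat.div_add_mod i.1 Q, ← Nat.div_add_mod i.2 Q]
    ring
  have hinj : Function.Injective fun i : Fin R × Fin S =>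
      Q * (n + (i.1 / Q + i.2 / Q * R)) + (i.1 % Q + i.2 % Q * R) := by
    intro i j hij
    simp only [hdigit, add_right_inj] at hij
    have hmod := congrArg (· % R) hij
    have hdiv := congrArg (· / R) hij
    simp only [Nat.add_mul_mod_self_left, Nat.add_mul_div_left _ _ i.1.pos,
      Nat.mod_eq_of_lt i.1.2, Nat.mod_eq_of_lt j.1.2, Nat.div_eq_of_lt i.1.2,
      Nat.div_eq_of_lt j.1.2, zero_add] at hmod hdiv
    exact Prod.ext (Fin.ext hmod) (Fin.ext hdiv)
  rw [Finset.mul_sum]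
  convert sum_smul_omega_pow_mul_pow_ne_zero hQ ha hτ hinj hd using 3 with i
  rw [mul_smul_comm]
  simp only [digitMonomial, pow_add, pow_mul]
  ring_nf

theorem degree_X_pow_sub_X_add_C {Q : ℕ} (hQ : 1 < Q) (γ : k) :
    (X ^ Q - X + C γ : k[X]).degree = Q := by
  rw [show (X ^ Q - X + C γ : k[X]) = X ^ Q + (C γ - X) by ring]
  have hlt : (C γ - X : k[X]).degree < (X ^ Q : k[X]).degree := by
    rw [degree_X_pow]
    refine (degree_sub_le _ _).trans_lt (max_lt ?_ ?_)
    · exact degree_C_le.trans_lt (by exact_mod_cast zero_lt_one.trans hQ)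
    · rw [degree_X]
      exact_mod_cast hQ
  rw [degree_add_eq_left_of_degree_lt hlt, degree_X_pow]

/-- The coordinate ring `k[x, y]` of the curve `x ^ 2 - (y ^ Q - y + γ) x + b = 0`, which for
`b ≠ 0` is the curve `y ^ Q - y = x + b / x - γ`. The coordinate `x` is `ω`, and `y` is the image
of `X`. -/
abbrev CurveRing (Q : ℕ) (b γ : k) : Type _ := QuadraticAlgebra k[X] (-C b) (X ^ Q - X + C γ)

theorem omega_mul_pow_eq (Q : ℕ) (b γ : k) :
    (ω : CurveRing Q b γ) * algebraMap k[X] _ X ^ Q =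
      ω * algebraMap k[X] _ X + aeval ω (X ^ 2 - C γ * X + C b : k[X]) := by
  have hω := omega_mul_omega_eq_algebraMap (a := -C b) (b := (X ^ Q - X + C γ : k[X]))
  simp only [map_neg, map_add, map_sub, map_pow, aeval_X, map_mul, aeval_C] at hω ⊢
  simp only [IsScalarTower.algebraMap_apply k k[X] (CurveRing Q b γ), Polynomial.algebraMap_eq]
  linear_combination -hω

/-- Evaluation at a point `(x₀, y₀)` of the curve. -/
def CurveRing.eval {Q : ℕ} {b γ x₀ y₀ : k}
    (h : x₀ * x₀ = -b + (y₀ ^ Q - y₀ + γ) * x₀) : CurveRing Q b γ →ₐ[k] k where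
  toFun z := z.re.eval y₀ + z.im.eval y₀ * x₀
  map_one' := by simp [re_one, im_one]
  map_mul' z w := by
    simp only [re_mul, im_mul, eval_add, eval_mul, eval_neg, eval_sub, eval_pow, eval_X, eval_C]
    linear_combination -(z.im.eval y₀ * w.im.eval y₀) * h
  map_zero' := by simp
  map_add' z w := by
    simp only [re_add, im_add, eval_add]
    ring
  commutes' c := by
    rw [IsScalarTower.algebraMap_apply k k[X] (CurveRing Q b γ)]
    simp

/-- Stepanov's bound: an auxiliary function on the curve `y ^ Q - y = x + b / x - γ` that vanishes
at all rational points has too few poles to vanish above more values of `x`. -/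
theorem card_exists_pow_sub_eq_add_div_le (F : Type*) [Field F] [Fintype F] [Fintype k]
    [DecidableEq k] [Algebra F k] (M : ℕ) (hk : Fintype.card k = (Fintype.card F ^ (M + 1)) ^ 2)
    (b γ : k) :
    #{x : k | x ≠ 0 ∧ ∃ y : k, y ^ Fintype.card F - y = x + b / x - γ} ≤
      Fintype.card F ^ M * Fintype.card F ^ (M + 1) + 6 * Fintype.card F ^ (M + 1) := by
  have hQ : 1 < Fintype.card F := Fintype.one_lt_card
  have hq : (X ^ 2 - C γ * X + C b : k[X]).natDegree ≤ 2 := by compute_degree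
  have hcurve := omega_mul_pow_eq (Fintype.card F) b γ
  obtain ⟨c, hc, i, hi⟩ := exists_sum_digitMonomial_eq_zero F hq hcurve M
  by_contra! hlt
  have hzero := eq_zero_of_mem_boxSpan_of_forall_exists_algHom F
    (mul_sum_digitMonomial_mem_boxSpan F hq hcurve M (c · ^ Fintype.card F ^ (M + 1))) hlt.le
    (fun x₀ hx₀ => by
      obtain ⟨hx₀, y₀, hy₀⟩ := (Finset.mem_filter.1 hx₀).2
      refine ⟨y₀, fun t => ?_⟩
      have hpoint : x₀ * x₀ = -b + ((y₀ + algebraMap F k t) ^ Fintype.card F -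
          (y₀ + algebraMap F k t) + γ) * x₀ := by
        have hfrob := map_add (FiniteField.frobeniusAlgHom F k) y₀ (algebraMap F k t)
        simp only [FiniteField.frobeniusAlgHom_apply, ← map_pow, FiniteField.pow_card] at hfrob
        field_simp at hy₀
        linear_combination -hy₀ - x₀ * hfrob
      exact ⟨CurveRing.eval hpoint, by simp [CurveRing.eval], by simp [CurveRing.eval],
        map_mul_sum_eq_zero_of_card_eq_sq F hk hc _⟩)
  exact omega_pow_mul_sum_smul_digitMonomial_ne_zero Fintype.card_pos
    ((degree_neg (C b)).trans_le (degree_C_le.trans (by exact_mod_cast zero_le)))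
    (degree_X_pow_sub_X_add_C hQ γ) _ ⟨i, pow_ne_zero _ hi⟩ hzero

end CurveRing

section Weil

variable {F : Type*} [Field F] [Fintype F]

section HilbertNinety

variable {k : Type*} [Field k] [Finite k] [Algebra F k]

theorem finrank_ker_frobenius_sub_id :
    Module.finrank F
      ↥(LinearMap.ker ((FiniteField.frobeniusAlgHom F k).toLinearMap - LinearMap.id)) = 1 := by
  suffices h : LinearMap.ker ((FiniteField.frobeniusAlgHom F k).toLinearMap - LinearMap.id) =
      (⊥ : IntermediateField F k).toSubmodule by
    rw [h]
    exact IntermediateField.finrank_bot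
  ext y
  rw [LinearMap.mem_ker, LinearMap.sub_apply, sub_eq_zero]
  refine Iff.trans ⟨fun hy σ => ?_, fun hy => ?_⟩ (IsGalois.mem_bot_iff_fixed y).symm
  · obtain ⟨i, rfl⟩ := (FiniteField.bijective_frobeniusAlgEquivOfAlgebraic_pow F k).surjective σ
    exact (congrFun (AlgEquiv.coe_pow _ _) y).trans (Function.iterate_fixed hy i)
  · exact hy (FiniteField.frobeniusAlgEquivOfAlgebraic F k)

theorem trace_eq_zero_iff_exists_pow_sub (z : k) :
    Algebra.trace F k z = 0 ↔ ∃ y : k, y ^ Fintype.card F - y = z := by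
  set f : k →ₗ[F] k := (FiniteField.frobeniusAlgHom F k).toLinearMap - LinearMap.id
  suffices h : LinearMap.range f = LinearMap.ker (Algebra.trace F k) by
    rw [← LinearMap.mem_ker, ← h]
    rfl
  refine Submodule.eq_of_le_of_finrank_eq ?_ ?_
  · rintro _ ⟨y, rfl⟩
    rw [LinearMap.mem_ker, LinearMap.sub_apply, map_sub, sub_eq_zero]
    exact Algebra.trace_eq_of_algEquiv (FiniteField.frobeniusAlgEquivOfAlgebraic F k) y
  · have hf := LinearMap.finrank_range_add_finrank_ker f
    have htr := LinearMap.finrank_range_add_finrank_ker (Algebra.trace F k)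
    rw [finrank_ker_frobenius_sub_id] at hf
    rw [LinearMap.range_eq_top.2 (Algebra.trace_surjective F k), finrank_top,
      Module.finrank_self] at htr
    omega

end HilbertNinety

theorem norm_sum_addChar_mul_le {ψ : AddChar F ℂ} (hψ : ψ ≠ 1) (N : F → ℕ) {S B : ℝ} (hB : 0 ≤ B)
    (hN : ∀ c, N c ≤ S + B) :
    ‖∑ c, ψ c * N c‖ ≤ 2 * B * Fintype.card F + (S * Fintype.card F - (∑ c, N c : ℕ)) := by
  have hshift : ∑ c, ψ c * N c = ∑ c, ψ c * ((N c - S : ℝ) : ℂ) := by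
    push_cast
    simp_rw [mul_sub, Finset.sum_sub_distrib, ← Finset.sum_mul,
      AddChar.sum_eq_zero_of_ne_one hψ, zero_mul, sub_zero]
  calc ‖∑ c, ψ c * N c‖ ≤ ∑ c, ‖ψ c * ((N c - S : ℝ) : ℂ)‖ := hshift ▸ norm_sum_le _ _
    _ ≤ ∑ c, (2 * B - (N c - S)) := by
      refine Finset.sum_le_sum fun c _ => ?_
      rw [norm_mul, AddChar.norm_apply, one_mul, Complex.norm_real, Real.norm_eq_abs]
      exact abs_le.2 ⟨by linarith [hN c], by linarith [hN c]⟩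
    _ = _ := by
      rw [Finset.sum_sub_distrib, Finset.sum_sub_distrib]
      simp only [Finset.sum_const, Finset.card_univ, nsmul_eq_mul]
      push_cast
      ring

theorem norm_kloostermanSum_traceChar_le {k : Type*} [Field k] [Fintype k] [DecidableEq k]
    [Algebra F k] {ψ : AddChar F ℂ} (hψ : ψ ≠ 1) (M : ℕ)
    (hk : Fintype.card k = (Fintype.card F ^ (M + 1)) ^ 2) (b : k) :
    ‖kloostermanSum (traceChar k ψ) b‖ ≤ 13 * Fintype.card F * Fintype.card F ^ (M + 1) := by
  classical
  set N : F → ℕ := fun c => #{x ∈ ({x | x ≠ 0} : Finset k) | Algebra.trace F k (x + b / x) = c}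
    with hN
  have hfiber : kloostermanSum (traceChar k ψ) b = ∑ c, ψ c * N c := by
    rw [kloostermanSum, ← Finset.sum_fiberwise _ fun x => Algebra.trace F k (x + b / x)]
    refine Finset.sum_congr rfl fun c _ => ?_
    rw [Finset.sum_congr rfl fun x hx => by rw [traceChar_apply, (Finset.mem_filter.1 hx).2],
      Finset.sum_const, nsmul_eq_mul, mul_comm]
  have hle (c : F) : (N c : ℝ) ≤
      (Fintype.card F : ℝ) ^ M * Fintype.card F ^ (M + 1) + 6 * Fintype.card F ^ (M + 1) := by
    obtain ⟨γ, rfl⟩ := Algebra.trace_surjective F k c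
    refine le_of_eq_of_le ?_
      (Nat.cast_le.2 (card_exists_pow_sub_eq_add_div_le F M hk b γ)) |>.trans_eq (by push_cast; rfl)
    simp only [hN, Finset.filter_filter, ← trace_eq_zero_iff_exists_pow_sub, map_sub, sub_eq_zero]
  have hsum : ((∑ c, N c : ℕ) : ℝ) + 1 = (Fintype.card F ^ (M + 1)) ^ 2 := by
    have hcard := Finset.card_erase_add_one (Finset.mem_univ (0 : k))
    rw [← Finset.filter_ne', Finset.card_eq_sum_card_fiberwise
      (f := fun x => Algebra.trace F k (x + b / x)) (t := Finset.univ) (by simp),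
      Finset.card_univ, hk] at hcard
    exact_mod_cast hcard
  have hone : (1 : ℝ) ≤ Fintype.card F * Fintype.card F ^ (M + 1) := by
    rw [← pow_succ']
    exact one_le_pow₀ (by exact_mod_cast Fintype.card_pos)
  have hbound := norm_sum_addChar_mul_le hψ N (by positivity) hle
  rw [← hfiber] at hbound
  linear_combination hbound + hone - hsum

theorem exists_finrank_eq_two (F : Type*) [Field F] [Finite F] :
    ∃ (E : Type) (_ : Field E) (_ : Fintype E) (_ : Algebra F E), Module.finrank F E = 2 := by
  obtain ⟨p, hp⟩ := CharP.exists F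
  have : Fact p.Prime := ⟨(CharP.char_is_prime_or_zero F p).resolve_right
    (CharP.char_ne_zero_of_finite F p)⟩
  exact ⟨FiniteField.Extension F p 2, inferInstance, Fintype.ofFinite _, inferInstance,
    FiniteField.finrank_extension F p 2⟩

section

variable [DecidableEq F] {ψ : AddChar F ℂ} (hψ : ψ ≠ 1) {b : F} (hb : b ≠ 0) {δ : ℝ} (hδ : 0 ≤ δ)
  (hK : (2 + δ) * √(Fintype.card F) ≤ ‖kloostermanSum ψ b‖)
include hψ hb hδ hK

theorem le_norm_kloostermanSum_of_finrank_two {E : Type*} [Field E] [Fintype E] [DecidableEq E]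
    [Algebra F E] (h : Module.finrank F E = 2) :
    (2 + 4 * δ) * √(Fintype.card E) ≤ ‖kloostermanSum (traceChar E ψ) (algebraMap F E b)‖ := by
  have hcard : √(Fintype.card E : ℝ) = Fintype.card F := by
    rw [Module.card_eq_pow_finrank (K := F), h, Nat.cast_pow, Real.sqrt_sq (by positivity)]
  rw [kloostermanSum_of_finrank_two h hψ hb, hcard]
  have hnorm := norm_sub_norm_le (kloostermanSum ψ b ^ 2) (2 * (Fintype.card F : ℂ))
  rw [norm_sub_rev, norm_pow, norm_mul, Complex.norm_natCast, Complex.norm_ofNat] at hnorm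
  have hsq : (2 + δ) ^ 2 * Fintype.card F ≤ ‖kloostermanSum ψ b‖ ^ 2 := by
    rw [← Real.sq_sqrt (Nat.cast_nonneg (α := ℝ) (Fintype.card F)), ← mul_pow]
    gcongr
  nlinarith [mul_nonneg (sq_nonneg δ) (Nat.cast_nonneg (α := ℝ) (Fintype.card F))]

theorem exists_extension_le_norm_kloostermanSum (j : ℕ) :
    ∃ (E : Type) (_ : Field E) (_ : Fintype E) (_ : DecidableEq E) (_ : Algebra F E),
      Module.finrank F E = 2 ^ (j + 1) ∧ (2 + 4 ^ (j + 1) * δ) * √(Fintype.card E) ≤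
        ‖kloostermanSum (traceChar E ψ) (algebraMap F E b)‖ := by
  classical
  induction j with
  | zero =>
    obtain ⟨E, _, _, _, h⟩ := exists_finrank_eq_two F
    exact ⟨E, _, _, inferInstance, _, by simpa using h,
      by simpa using le_norm_kloostermanSum_of_finrank_two hψ hb hδ hK h⟩
  | succ j ih =>
    obtain ⟨E, _, _, _, _, hrank, hE⟩ := ih
    obtain ⟨L, _, _, _, hL⟩ := exists_finrank_eq_two E
    let _ : Algebra F L := ((algebraMap E L).comp (algebraMap F E)).toAlgebra
    have : IsScalarTower F E L := IsScalarTower.of_algebraMap_eq' rfl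
    refine ⟨L, inferInstance, inferInstance, inferInstance, inferInstance, ?_, ?_⟩
    · rw [← Module.finrank_mul_finrank F E L, hrank, hL, ← pow_succ]
    · have hnorm := le_norm_kloostermanSum_of_finrank_two (traceChar_ne_one (E := E) hψ)
        ((map_ne_zero (algebraMap F E)).2 hb) (by positivity) hE hL
      rwa [traceChar_traceChar, ← IsScalarTower.algebraMap_apply, ← mul_assoc,
        ← pow_succ'] at hnorm

end

/-- An excess over `2 * √|F|` would grow along a tower of quadratic extensions until
it contradicts Stepanov's bound. -/
theorem norm_kloostermanSum_le_of_ne_zero [DecidableEq F] {ψ : AddChar F ℂ} (hψ : ψ ≠ 1) {b : F}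
    (hb : b ≠ 0) : ‖kloostermanSum ψ b‖ ≤ 2 * √(Fintype.card F) := by
  by_contra! hlt
  have hQ : 0 < √(Fintype.card F : ℝ) := Real.sqrt_pos.2 (by exact_mod_cast Fintype.card_pos)
  obtain ⟨δ, hδ, hK⟩ : ∃ δ > 0, ‖kloostermanSum ψ b‖ = (2 + δ) * √(Fintype.card F) :=
    ⟨‖kloostermanSum ψ b‖ / √(Fintype.card F) - 2, by rwa [gt_iff_lt, sub_pos, lt_div_iff₀ hQ],
      by field_simp; ring⟩
  obtain ⟨j, hj⟩ := pow_unbounded_of_one_lt (13 * Fintype.card F / δ) (by norm_num : (1 : ℝ) < 4)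
  obtain ⟨E, _, _, _, _, hrank, hE⟩ :=
    exists_extension_le_norm_kloostermanSum hψ hb hδ.le hK.ge j
  obtain ⟨M, hM⟩ : ∃ M, 2 ^ j = M + 1 := Nat.exists_eq_succ_of_ne_zero (by positivity)
  have hcard : Fintype.card E = (Fintype.card F ^ (M + 1)) ^ 2 := by
    rw [Module.card_eq_pow_finrank (K := F), hrank, ← hM, ← pow_mul, pow_succ]
  have hstepanov := hE.trans (norm_kloostermanSum_traceChar_le hψ M hcard (algebraMap F E b))
  have hR : 0 < (Fintype.card F : ℝ) ^ (M + 1) := by positivity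
  rw [hcard, Nat.cast_pow, Nat.cast_pow, Real.sqrt_sq hR.le] at hstepanov
  rw [div_lt_iff₀ hδ] at hj
  have hgrow : (4 : ℝ) ^ j * δ ≤ 4 ^ (j + 1) * δ := by gcongr <;> norm_num
  linarith [le_of_mul_le_mul_right hstepanov hR]

end Weil

section PolarForm

variable {K V : Type*} [Field K] [AddCommGroup V] [Module K V]

theorem mem_sup_span_singleton_comm {W : Submodule K V} {x z : V} (hx : x ∉ W) (hz : z ∉ W) :
    x ∈ W ⊔ K ∙ z ↔ z ∈ W ⊔ K ∙ x := by
  have hspan (y : V) : W ⊔ K ∙ y = Submodule.span K (insert y W) := by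
    rw [Submodule.span_insert, Submodule.span_eq, sup_comm]
  rw [hspan, hspan]
  exact ⟨fun h => mem_span_insert_exchange h (by rwa [Submodule.span_eq]),
    fun h => mem_span_insert_exchange h (by rwa [Submodule.span_eq])⟩

theorem natCard_sup_span_singleton [Finite V] {W : Submodule K V} {z : V} (hz : z ∉ W) :
    Nat.card ↥(W ⊔ K ∙ z) = Nat.card K * Nat.card W := by
  rw [Module.natCard_eq_pow_finrank (K := K), Submodule.finrank_sup_span_singleton hz,
    Module.natCard_eq_pow_finrank (K := K) (V := W), pow_succ']

/-- The vectors that are perpendicular to a subspace for a form `β`. -/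
def perp (β : V → V → K) (W : Submodule K V) : Set V := {x | ∀ w ∈ W, β x w = 0}

/-- The vectors in `perp β W` that are isotropic (or singular); these are given by a predicate `P`,
so that sesquilinear and quadratic forms can be treated together. -/
def isotropicPerp (β : V → V → K) (P : V → Prop) (W : Submodule K V) : Set V :=
  {x | P x ∧ x ∈ perp β W}

/-- The totally isotropic (or totally singular) subspaces for the isotropy predicate `P`. -/
def TotallyPolar (β : V → V → K) (P : V → Prop) (W : Submodule K V) : Prop :=
  (W : Set V) ⊆ isotropicPerp β P W

/-- A form `β` and a predicate `P`, the isotropic (or singular) vectors, that define a polar space.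
In the second argument only what follows from reflexivity is required, in order to include
Hermitian forms. -/
structure IsPolarForm (β : V → V → K) (P : V → Prop) : Prop where
  add_left : ∀ x y z, β (x + y) z = β x z + β y z
  smul_left : ∀ (c : K) x z, β (c • x) z = c * β x z
  refl : ∀ x y, β x y = 0 → β y x = 0
  zero : P 0
  smul : ∀ (c : K) x, P x → P (c • x)
  add : ∀ x y, P x → P y → β x y = 0 → P (x + y)
  self : ∀ x, P x → β x x = 0

namespace IsPolarForm

variable {β : V → V → K} {P : V → Prop} (h : IsPolarForm β P) {W : Submodule K V} {x z : V}
include h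

theorem zero_left : β 0 x = 0 := by simpa using h.smul_left 0 0 x

theorem zero_right : β x 0 = 0 := h.refl _ _ h.zero_left

theorem add_smul_right {y : V} (c : K) (hy : β x y = 0) (hz : β x z = 0) :
    β x (y + c • z) = 0 := by
  apply h.refl
  rw [h.add_left, h.smul_left, h.refl _ _ hy, h.refl _ _ hz, mul_zero, add_zero]

theorem mem_perp_bot : x ∈ perp β ⊥ := by
  rintro w rfl
  exact h.zero_right

theorem mem_perp_sup_span_singleton : x ∈ perp β (W ⊔ K ∙ z) ↔ x ∈ perp β W ∧ β x z = 0 := by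
  refine ⟨fun hx => ⟨fun w hw => hx w (Submodule.mem_sup_left hw),
    hx z (Submodule.mem_sup_right (Submodule.mem_span_singleton_self z))⟩, fun ⟨hW, hz⟩ y hy => ?_⟩
  obtain ⟨w, hw, _, hcz, rfl⟩ := Submodule.mem_sup.1 hy
  obtain ⟨c, rfl⟩ := Submodule.mem_span_singleton.1 hcz
  exact h.add_smul_right c (hW w hw) hz

theorem totallyPolar_bot : TotallyPolar β P ⊥ := by
  rintro x rfl
  exact ⟨h.zero, h.mem_perp_bot⟩

theorem totallyPolar_sup_span_singleton (hW : TotallyPolar β P W)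
    (hz : z ∈ isotropicPerp β P W) : TotallyPolar β P (W ⊔ K ∙ z) := by
  intro y hy
  obtain ⟨w, hw, _, hcz, rfl⟩ := Submodule.mem_sup.1 hy
  obtain ⟨c, rfl⟩ := Submodule.mem_span_singleton.1 hcz
  have hwz : β w z = 0 := h.refl _ _ (hz.2 w hw)
  refine ⟨h.add _ _ (hW hw).1 (h.smul c z hz.1) ?_, h.mem_perp_sup_span_singleton.2
    ⟨fun u hu => ?_, ?_⟩⟩
  · exact h.refl _ _ (by rw [h.smul_left, hz.2 w hw, mul_zero])
  · rw [h.add_left, h.smul_left, (hW hw).2 u hu, hz.2 u hu, mul_zero, add_zero]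
  · rw [h.add_left, h.smul_left, hwz, h.self z hz.1, mul_zero, add_zero]

end IsPolarForm

end PolarForm

section Counting

open scoped Classical

variable {K V : Type*} [Field K] [AddCommGroup V] [Module K V] [Fintype V] {β : V → V → K}
  {P : V → Prop} {W : Submodule K V} {ρ : ℝ} {d : V}

variable (β P) in
/-- The numbers of isotropic vectors perpendicular to the totally isotropic subspaces are those of
a form of minus type. The value of `ρ` is `1` for symplectic forms, `√|K|` for Hermitian forms, and
`|K|` for quadratic forms. -/
def HasMinusPerpCounts (ρ : ℝ) : Prop :=
  ∀ W : Submodule K V, TotallyPolar β P W →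
    ρ * (#{x | x ∈ isotropicPerp β P W} * Nat.card W) =
      Fintype.card V - (ρ - 1) * (√(Fintype.card V) * Nat.card W)

variable (β P) in
/-- The vectors that extend a totally isotropic subspace to a larger one. -/
def extensionVectors (W : Submodule K V) : Finset V := {z | z ∈ isotropicPerp β P W ∧ z ∉ W}

theorem mem_extensionVectors {z : V} :
    z ∈ extensionVectors β P W ↔ z ∈ isotropicPerp β P W ∧ z ∉ W := by
  simp [extensionVectors]

theorem card_filter_notMem_add_natCard {S : Set V} (hW : (W : Set V) ⊆ S) :
    #{x | x ∈ S ∧ x ∉ W} + Nat.card W = #{x | x ∈ S} := by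
  rw [← Finset.card_filter_add_card_filter_not (s := ({x | x ∈ S} : Finset V)) (· ∉ W),
    Finset.filter_filter, Finset.filter_filter, Nat.card_eq_fintype_card, Fintype.card_subtype]
  congr 2
  ext x
  simpa using @hW x

variable (β) in
/-- The weight through which a set of isotropic vectors is counted: its sum over the set combines
the numbers of elements in `perp β W` and in `W`. -/
def perpWeight (W : Submodule K V) (d : V) : ℝ :=
  (if d ∈ perp β W then (Nat.card W : ℝ) else 0) + if d ∈ W then √(Fintype.card V) else 0

theorem perpWeight_of_mem (hW : TotallyPolar β P W) (hd : d ∈ W) :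
    perpWeight β W d = √(Fintype.card V) + Nat.card W := by
  rw [perpWeight, if_pos (hW hd).2, if_pos hd, add_comm]

theorem perpWeight_of_mem_extensionVectors (hd : d ∈ extensionVectors β P W) :
    perpWeight β W d = Nat.card W := by
  obtain ⟨hdP, hdW⟩ := mem_extensionVectors.1 hd
  rw [perpWeight, if_pos hdP.2, if_neg hdW, add_zero]

theorem perpWeight_of_notMem_perp (hW : TotallyPolar β P W) (hd : d ∉ perp β W) :
    perpWeight β W d = 0 := by
  have hdW : d ∉ W := fun hdW => hd (hW hdW).2
  rw [perpWeight, if_neg hd, if_neg hdW, add_zero]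

section

variable (h : IsPolarForm β P) (hW : TotallyPolar β P W)
include h hW

theorem card_extensionVectors_mem_sup_add (hd : d ∈ extensionVectors β P W) :
    #{z ∈ extensionVectors β P W | d ∈ W ⊔ K ∙ z} + Nat.card W = Nat.card K * Nat.card W := by
  obtain ⟨hdP, hdW⟩ := mem_extensionVectors.1 hd
  have hWd := h.totallyPolar_sup_span_singleton hW hdP
  have hcard := card_filter_notMem_add_natCard (W := W) (S := ↑(W ⊔ K ∙ d))
    (SetLike.coe_subset_coe.2 le_sup_left)
  rw [← natCard_sup_span_singleton hdW, Nat.card_eq_fintype_card (α := ↥(W ⊔ K ∙ d)),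
    Fintype.card_subtype]
  refine (congrArg (#· + _) ?_).trans hcard
  ext z
  simp only [Finset.mem_filter, Finset.mem_univ, true_and, mem_extensionVectors, SetLike.mem_coe]
  refine ⟨fun ⟨⟨_, hz⟩, hdz⟩ => ⟨(mem_sup_span_singleton_comm hdW hz).1 hdz, hz⟩, fun ⟨hzd, hz⟩ =>
    ⟨⟨⟨(hWd hzd).1, fun w hw => (hWd hzd).2 w (Submodule.mem_sup_left hw)⟩, hz⟩,
      (mem_sup_span_singleton_comm hdW hz).2 hzd⟩⟩

theorem card_extensionVectors_perp_sup_add (hd : d ∈ extensionVectors β P W) :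
    #{z ∈ extensionVectors β P W | d ∈ perp β (W ⊔ K ∙ z)} + Nat.card W =
      #{z | z ∈ isotropicPerp β P (W ⊔ K ∙ d)} := by
  obtain ⟨hdP, _⟩ := mem_extensionVectors.1 hd
  have hWd := h.totallyPolar_sup_span_singleton hW hdP
  refine (congrArg (#· + _) ?_).trans
    (card_filter_notMem_add_natCard fun w hw => hWd (Submodule.mem_sup_left hw))
  ext z
  simp only [Finset.mem_filter, Finset.mem_univ, true_and, mem_extensionVectors, isotropicPerp,
    Set.mem_ofPred_eq, h.mem_perp_sup_span_singleton]
  exact ⟨fun ⟨⟨⟨hzP, hzW⟩, hz⟩, _, hdz⟩ => ⟨⟨hzP, hzW, h.refl _ _ hdz⟩, hz⟩,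
    fun ⟨⟨hzP, hzW, hzd⟩, hz⟩ => ⟨⟨⟨hzP, hzW⟩, hz⟩, hdP.2, h.refl _ _ hzd⟩⟩

theorem sum_perpWeight_sup_of_mem (hd : d ∈ W) :
    ∑ z ∈ extensionVectors β P W, perpWeight β (W ⊔ K ∙ z) d =
      #(extensionVectors β P W) * (√(Fintype.card V) + Nat.card K * Nat.card W) := by
  rw [← nsmul_eq_mul]
  refine Finset.sum_eq_card_nsmul fun z hz => ?_
  obtain ⟨hzP, hzW⟩ := mem_extensionVectors.1 hz
  rw [perpWeight_of_mem (h.totallyPolar_sup_span_singleton hW hzP) (Submodule.mem_sup_left hd),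
    natCard_sup_span_singleton hzW, Nat.cast_mul]

theorem sum_perpWeight_sup_of_notMem_perp (hd : d ∉ perp β W) :
    ∑ z ∈ extensionVectors β P W, perpWeight β (W ⊔ K ∙ z) d = 0 :=
  Finset.sum_eq_zero fun _ hz => perpWeight_of_notMem_perp
    (h.totallyPolar_sup_span_singleton hW (mem_extensionVectors.1 hz).1)
    fun hdz => hd (h.mem_perp_sup_span_singleton.1 hdz).1

theorem mul_sum_perpWeight_sup_of_mem_extensionVectors (hcount : HasMinusPerpCounts β P ρ)
    (hd : d ∈ extensionVectors β P W) :
    ρ * ∑ z ∈ extensionVectors β P W, perpWeight β (W ⊔ K ∙ z) d =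
      (√(Fintype.card V) + Nat.card K * Nat.card W) * (√(Fintype.card V) - ρ * Nat.card W) := by
  obtain ⟨hdP, hdW⟩ := mem_extensionVectors.1 hd
  have hsum : ∑ z ∈ extensionVectors β P W, perpWeight β (W ⊔ K ∙ z) d =
      #{z ∈ extensionVectors β P W | d ∈ perp β (W ⊔ K ∙ z)} * (Nat.card K * Nat.card W) +
        #{z ∈ extensionVectors β P W | d ∈ W ⊔ K ∙ z} * √(Fintype.card V) := by
    simp_rw [perpWeight, Finset.sum_add_distrib, ← Finset.sum_filter, Finset.sum_const,
      nsmul_eq_mul]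
    congr 1
    rw [Finset.sum_congr rfl fun _ hz => by rw [natCard_sup_span_singleton
      (mem_extensionVectors.1 (Finset.mem_filter.1 hz).1).2], Finset.sum_const, nsmul_eq_mul,
      Nat.cast_mul]
  have hmem : (_ : ℝ) = _ := congrArg Nat.cast (card_extensionVectors_mem_sup_add h hW hd)
  have hperp := hcount _ (h.totallyPolar_sup_span_singleton hW hdP)
  rw [natCard_sup_span_singleton hdW, ← card_extensionVectors_perp_sup_add h hW hd] at hperp
  push_cast at hmem hperp
  have hV := Real.sq_sqrt (Nat.cast_nonneg (α := ℝ) (Fintype.card V))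
  rw [hsum]
  linear_combination ρ * √(Fintype.card V) * hmem + hperp - hV

end

theorem mul_natCard_mul_card_extensionVectors (hcount : HasMinusPerpCounts β P ρ)
    (hW : TotallyPolar β P W) :
    ρ * Nat.card W * #(extensionVectors β P W) =
      (√(Fintype.card V) + Nat.card W) * (√(Fintype.card V) - ρ * Nat.card W) := by
  have hperp := hcount W hW
  rw [← card_filter_notMem_add_natCard hW] at hperp
  push_cast at hperp
  rw [extensionVectors]
  linear_combination hperp - Real.sq_sqrt (Nat.cast_nonneg (α := ℝ) (Fintype.card V))

theorem extensionVectors_nonempty (hW : TotallyPolar β P W)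
    (hmax : ¬ Maximal (TotallyPolar β P) W) : (extensionVectors β P W).Nonempty := by
  obtain ⟨U, hWU, hU⟩ := (not_maximal_iff_exists_gt hW).1 hmax
  obtain ⟨z, hz, hzW⟩ := SetLike.exists_of_lt hWU
  exact ⟨z, mem_extensionVectors.2
    ⟨⟨(hU hz).1, fun w hw => (hU hz).2 w (hWU.le hw)⟩, hzW⟩⟩

section

variable (h : IsPolarForm β P) {D : Finset V} (hD : ∀ x ∈ D, P x) {N : ℝ}
include h hD

theorem sum_perpWeight_of_maximal (hW : Maximal (TotallyPolar β P) W) :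
    ∑ d ∈ D, perpWeight β W d =
      #{d ∈ D | d ∈ W} * (√(Fintype.card V) + Nat.card W) := by
  rw [← nsmul_eq_mul, ← Finset.sum_const, Finset.sum_filter]
  refine Finset.sum_congr rfl fun d hd => ?_
  split_ifs with hdW
  · exact perpWeight_of_mem hW.1 hdW
  · refine perpWeight_of_notMem_perp hW.1 fun hdP => hdW ?_
    exact hW.2 (h.totallyPolar_sup_span_singleton hW.1 ⟨hD d hd, hdP⟩) le_sup_left
      (Submodule.mem_sup_right (Submodule.mem_span_singleton_self d))

theorem sum_perpWeight_of_forall_extensionVectors (hρ : 0 < ρ) (hcount : HasMinusPerpCounts β P ρ)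
    (hW : TotallyPolar β P W) (hne : (extensionVectors β P W).Nonempty)
    (hext : ∀ z ∈ extensionVectors β P W, ∑ d ∈ D, perpWeight β (W ⊔ K ∙ z) d =
      N * (√(Fintype.card V) + Nat.card K * Nat.card W)) :
    ∑ d ∈ D, perpWeight β W d = N * (√(Fintype.card V) + Nat.card W) := by
  have hcard := mul_natCard_mul_card_extensionVectors hcount hW
  have hweight : ∀ d ∈ D, (√(Fintype.card V) + Nat.card W) *
      (ρ * Nat.card W * ∑ z ∈ extensionVectors β P W, perpWeight β (W ⊔ K ∙ z) d) =
      (√(Fintype.card V) + Nat.card K * Nat.card W) * (ρ * Nat.card W * #(extensionVectors β P W)) *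
        perpWeight β W d := by
    intro d hd
    by_cases hdW : d ∈ W
    · rw [sum_perpWeight_sup_of_mem h hW hdW, perpWeight_of_mem hW hdW]
      ring
    by_cases hdP : d ∈ extensionVectors β P W
    · rw [hcard, perpWeight_of_mem_extensionVectors hdP]
      linear_combination (√(Fintype.card V) + Nat.card W) * Nat.card W *
        mul_sum_perpWeight_sup_of_mem_extensionVectors h hW hcount hdP
    · have hdperp : d ∉ perp β W := fun hd' => hdP (mem_extensionVectors.2 ⟨⟨hD d hd, hd'⟩, hdW⟩)
      rw [sum_perpWeight_sup_of_notMem_perp h hW hdperp, perpWeight_of_notMem_perp hW hdperp]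
      ring
  have hpos : (√(Fintype.card V) + Nat.card K * Nat.card W : ℝ) *
      (ρ * Nat.card W * #(extensionVectors β P W)) ≠ 0 := by
    have : 0 < √(Fintype.card V : ℝ) := Real.sqrt_pos.2 (by exact_mod_cast Fintype.card_pos)
    have : (0 : ℝ) < Nat.card W := by exact_mod_cast Nat.card_pos
    have : (0 : ℝ) < #(extensionVectors β P W) := by exact_mod_cast hne.card_pos
    positivity
  apply mul_left_cancel₀ hpos
  rw [Finset.mul_sum, ← Finset.sum_congr rfl hweight, ← Finset.mul_sum, ← Finset.mul_sum,
    Finset.sum_comm, Finset.sum_congr rfl hext, Finset.sum_const, nsmul_eq_mul]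
  ring

theorem sum_perpWeight_of_card_maximal (hρ : 0 < ρ) (hcount : HasMinusPerpCounts β P ρ)
    (hN : ∀ W, Maximal (TotallyPolar β P) W → (#{d ∈ D | d ∈ W} : ℝ) = N)
    (hW : TotallyPolar β P W) :
    ∑ d ∈ D, perpWeight β W d = N * (√(Fintype.card V) + Nat.card W) := by
  induction W using WellFoundedGT.induction with
  | ind W ih =>
  by_cases hmax : Maximal (TotallyPolar β P) W
  · rw [sum_perpWeight_of_maximal h hD hmax, hN W hmax]
  · refine sum_perpWeight_of_forall_extensionVectors h hD hρ hcount hW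
      (extensionVectors_nonempty hW hmax) fun z hz => ?_
    obtain ⟨hzP, hzW⟩ := mem_extensionVectors.1 hz
    have hlt : W < W ⊔ K ∙ z := left_lt_sup.2 fun hle =>
      hzW (hle (Submodule.mem_span_singleton_self z))
    rw [ih _ hlt (h.totallyPolar_sup_span_singleton hW hzP), natCard_sup_span_singleton hzW,
      Nat.cast_mul]

end

end Counting

section Fourier

open scoped Classical

theorem sum_ne_zero_addChar_mul {K : Type*} [Field K] [Fintype K] {ψ : AddChar K ℂ}
    (hψ : ψ ≠ 1) (t : K) :
    ∑ c with c ≠ 0, ψ (c * t) = (if t = 0 then (Fintype.card K : ℂ) else 0) - 1 := by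
  rw [Finset.filter_ne', Finset.sum_erase_eq_sub (Finset.mem_univ _), zero_mul,
    AddChar.map_zero_eq_one]
  congr 1
  split_ifs with ht
  · simp [ht]
  · exact sum_addChar_mul_eq_zero hψ ht

variable {K V : Type*} [Field K] [AddCommGroup V] [Module K V] {ψ : AddChar K ℂ}

section

variable {D : Finset V} (hDsmul : ∀ c : K, c ≠ 0 → ∀ x ∈ D, c • x ∈ D)
include hDsmul

theorem sum_addChar_smul {c : K} (hc : c ≠ 0) {g : V → K} (hg : ∀ x, g (c • x) = c * g x) :
    ∑ x ∈ D, ψ (c * g x) = ∑ x ∈ D, ψ (g x) :=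
  Finset.sum_bij (fun x _ => c • x) (hDsmul c hc) (fun _ _ _ _ hxy => smul_right_injective V hc hxy)
    (fun y hy => ⟨c⁻¹ • y, hDsmul _ (inv_ne_zero hc) y hy, smul_inv_smul₀ hc y⟩)
    fun x _ => by rw [hg]

theorem sub_one_mul_sum_addChar [Fintype K] (hψ : ψ ≠ 1) {g : V → K}
    (hg : ∀ (c : K) x, g (c • x) = c * g x) :
    (Fintype.card K - 1 : ℂ) * ∑ x ∈ D, ψ (g x) =
      Fintype.card K * #{x ∈ D | g x = 0} - #D := by
  calc (Fintype.card K - 1 : ℂ) * ∑ x ∈ D, ψ (g x)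
    _ = ∑ c : K with c ≠ 0, ∑ x ∈ D, ψ (g x) := by
      rw [Finset.sum_const, nsmul_eq_mul, Finset.filter_ne',
        Finset.card_erase_of_mem (Finset.mem_univ _), Finset.card_univ,
        Nat.cast_pred Fintype.card_pos]
    _ = ∑ x ∈ D, ∑ c : K with c ≠ 0, ψ (c * g x) := by
      rw [Finset.sum_comm (s := D)]
      exact Finset.sum_congr rfl fun c hc =>
        (sum_addChar_smul hDsmul (Finset.mem_filter.1 hc).2 (hg c)).symm
    _ = Fintype.card K * #{x ∈ D | g x = 0} - #D := by
      simp_rw [sum_ne_zero_addChar_mul hψ]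
      rw [Finset.sum_sub_distrib, ← Finset.sum_filter, Finset.sum_const, Finset.sum_const,
        nsmul_eq_mul, nsmul_eq_mul, mul_one, mul_comm]

theorem card_filter_mem_span_singleton [Fintype K] (hD0 : (0 : V) ∉ D) {z : V} (hz : z ∈ D) :
    #{x ∈ D | x ∈ K ∙ z} = Fintype.card K - 1 := by
  have himage : {x ∈ D | x ∈ K ∙ z} = (Finset.univ.erase (0 : K)).image (· • z) := by
    ext x
    simp only [Finset.mem_filter, Submodule.mem_span_singleton, Finset.mem_image,
      Finset.mem_erase, Finset.mem_univ, and_true]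
    constructor
    · rintro ⟨hx, c, rfl⟩
      exact ⟨c, fun hc => hD0 (by rwa [hc, zero_smul] at hx), rfl⟩
    · rintro ⟨c, hc, rfl⟩
      exact ⟨hDsmul c hc z hz, c, rfl⟩
  rw [himage, Finset.card_image_of_injective _
    (smul_left_injective K (ne_of_mem_of_not_mem hz hD0)),
    Finset.card_erase_of_mem (Finset.mem_univ _), Finset.card_univ]

end

variable [Fintype V] {β : V → V → K} {P : V → Prop} (h : IsPolarForm β P) {ρ : ℝ} (hρ : 0 < ρ)
  (hcount : HasMinusPerpCounts β P ρ) {D : Finset V} (hD : ∀ x ∈ D, P x) (hD0 : (0 : V) ∉ D)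
  {N : ℝ} (hN : ∀ W, Maximal (TotallyPolar β P) W → (#{d ∈ D | d ∈ W} : ℝ) = N)
include h hρ hcount hD hD0 hN

theorem card_eq_of_card_maximal : (#D : ℝ) = N * (√(Fintype.card V) + 1) := by
  have hsum := sum_perpWeight_of_card_maximal h hD hρ hcount hN h.totallyPolar_bot
  rw [Nat.card_unique, Nat.cast_one] at hsum
  rw [← hsum, Finset.cast_card]
  refine Finset.sum_congr rfl fun d hd => ?_
  have hd0 : d ∉ (⊥ : Submodule K V) := ne_of_mem_of_not_mem hd hD0
  rw [perpWeight, if_pos h.mem_perp_bot, if_neg hd0, Nat.card_unique, Nat.cast_one, add_zero]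

theorem card_perp_of_card_maximal [Fintype K] (hDsmul : ∀ c : K, c ≠ 0 → ∀ x ∈ D, c • x ∈ D) {z : V}
    (hz : z ∈ D) :
    Fintype.card K * (#{x ∈ D | β x z = 0} : ℝ) + (Fintype.card K - 1) * √(Fintype.card V) =
      N * (√(Fintype.card V) + Fintype.card K) := by
  have hzP : z ∈ isotropicPerp β P ⊥ := ⟨hD z hz, h.mem_perp_bot⟩
  have hz0 : z ∉ (⊥ : Submodule K V) := ne_of_mem_of_not_mem hz hD0
  have hsum := sum_perpWeight_of_card_maximal h hD hρ hcount hN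
    (h.totallyPolar_sup_span_singleton h.totallyPolar_bot hzP)
  have hperp (x : V) : x ∈ perp β (⊥ ⊔ K ∙ z) ↔ β x z = 0 := by
    rw [h.mem_perp_sup_span_singleton, and_iff_right h.mem_perp_bot]
  simp_rw [perpWeight, Finset.sum_add_distrib, hperp, ← Finset.sum_filter, Finset.sum_const,
    nsmul_eq_mul, natCard_sup_span_singleton hz0, bot_sup_eq,
    card_filter_mem_span_singleton hDsmul hD0 hz, Nat.card_unique, mul_one,
    Nat.card_eq_fintype_card, Nat.cast_pred Fintype.card_pos] at hsum
  linear_combination hsum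

theorem sum_addChar_of_card_maximal [Finite K]
    (hDsmul : ∀ c : K, c ≠ 0 → ∀ x ∈ D, c • x ∈ D) (hψ : ψ ≠ 1) {z : V} (hz : z ∈ D) :
    ∑ x ∈ D, ψ (β x z) = ((N - √(Fintype.card V) : ℝ) : ℂ) := by
  cases nonempty_fintype K
  have hK : (Fintype.card K - 1 : ℂ) ≠ 0 :=
    sub_ne_zero.2 (by exact_mod_cast Fintype.one_lt_card.ne')
  have hreal : (Fintype.card K : ℝ) * #{x ∈ D | β x z = 0} - #D =
      (Fintype.card K - 1) * (N - √(Fintype.card V)) := by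
    linear_combination card_perp_of_card_maximal h hρ hcount hD hD0 hN hDsmul hz -
      card_eq_of_card_maximal h hρ hcount hD hD0 hN
  apply mul_left_cancel₀ hK
  rw [sub_one_mul_sum_addChar hDsmul hψ fun c x => h.smul_left c x z]
  exact_mod_cast congrArg Complex.ofReal hreal

end Fourier

section MinusType

open QuadraticMap (polar polar_comm polar_smul_right polarBilin_apply_apply)

open scoped Classical

theorem sum_addChar_linearMap {F W : Type*} [Field F] [AddCommGroup W] [Module F W] [Fintype W]
    {ψ : AddChar F ℂ} (hψ : ψ ≠ 1) (ℓ : W →ₗ[F] F) :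
    ∑ w, ψ (ℓ w) = if ℓ = 0 then (Fintype.card W : ℂ) else 0 := by
  split_ifs with hℓ
  · simp [hℓ]
  · obtain ⟨t, ht⟩ := AddChar.ne_one_iff.1 hψ
    obtain ⟨w, rfl⟩ := LinearMap.surjective hℓ t
    exact AddChar.sum_eq_zero_of_ne_one (ψ := ψ.compAddMonoidHom ℓ.toAddMonoidHom)
      (AddChar.ne_one_iff.2 ⟨w, ht⟩)

variable {F V : Type*} [Field F] [AddCommGroup V] [Module F V] [Fintype V]
  {R : QuadraticForm F V} {ψ : AddChar F ℂ}

theorem sum_addChar_polar_submodule (hψ : ψ ≠ 1) (W : Submodule F V) (x : V) :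
    ∑ w : W, ψ (polar R x w) = if x ∈ perp (polar R) W then (Nat.card W : ℂ) else 0 := by
  have hperp : x ∈ perp (polar R) W ↔ (R.polarBilin x).domRestrict W = 0 := by
    simp [perp, LinearMap.ext_iff]
  have hsum := sum_addChar_linearMap hψ ((R.polarBilin x).domRestrict W)
  simp only [← hperp, ← Nat.card_eq_fintype_card] at hsum
  exact hsum

/-- A quadratic form over a finite field is of minus type if its Gauss sums are those of a
nondegenerate elliptic form, that is, `-q ^ k` in dimension `2 * k`. -/
def IsMinusType (R : QuadraticForm F V) : Prop :=
  ∀ ψ : AddChar F ℂ, ψ ≠ 1 → ∑ x, ψ (R x) = -√(Fintype.card V)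

theorem ofReal_sqrt_natCast_sq (n : ℕ) : ((√n : ℝ) : ℂ) ^ 2 = n := by
  exact_mod_cast Real.sq_sqrt (Nat.cast_nonneg (α := ℝ) n)

theorem exists_mul_ne_one (hψ : ψ ≠ 1) {c : F} (hc : c ≠ 0) : ∃ s ≠ 0, ψ (s * c) ≠ 1 := by
  obtain ⟨t, ht⟩ := AddChar.ne_one_iff.1 hψ
  refine ⟨t / c, div_ne_zero ?_ hc, by rwa [div_mul_cancel₀ _ hc]⟩
  rintro rfl
  exact ht ψ.map_zero_eq_one

namespace IsMinusType

variable (hR : IsMinusType R)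
include hR

theorem sum_addChar_mul (hψ : ψ ≠ 1) {s : F} (hs : s ≠ 0) :
    ∑ x, ψ (s * R x) = -√(Fintype.card V) := by
  simpa using hR (ψ.mulShift s) (AddChar.IsPrimitive.of_ne_one hψ hs)

/-- Completing the square. -/
theorem sum_addChar_mul_add_polar (hψ : ψ ≠ 1) {s : F} (hs : s ≠ 0) (y : V) :
    ∑ x, ψ (s * R x + polar R x y) = -√(Fintype.card V) * ψ (-(R y / s)) := by
  rw [← hR.sum_addChar_mul hψ hs, Finset.sum_mul,
    ← Equiv.sum_comp (Equiv.addRight (s⁻¹ • y)) fun x => ψ (s * R x) * _]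
  refine Finset.sum_congr rfl fun x _ => ?_
  rw [← AddChar.map_add_eq_mul, Equiv.coe_addRight, QuadraticMap.map_add R, QuadraticMap.map_smul,
    polar_smul_right, smul_eq_mul, smul_eq_mul]
  congr 1
  field_simp
  ring

theorem map_eq_zero_of_polarBilin_eq_zero (hψ : ψ ≠ 1) {y : V} (hy : R.polarBilin y = 0) :
    R y = 0 := by
  by_contra hRy
  obtain ⟨s, hs, hsy⟩ := exists_mul_ne_one hψ (neg_ne_zero.2 hRy)
  have hV : -(√(Fintype.card V) : ℂ) ≠ 0 := by simp
  have hsum := hR.sum_addChar_mul_add_polar hψ (inv_ne_zero hs) y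
  have hpolar (x : V) : polar R x y = 0 := by
    rw [polar_comm]
    exact LinearMap.congr_fun hy x
  simp only [hpolar, add_zero, hR.sum_addChar_mul hψ (inv_ne_zero hs), div_inv_eq_mul] at hsum
  refine hsy (mul_left_cancel₀ hV ?_)
  rw [mul_one, mul_comm s, neg_mul (R y)]
  exact hsum.symm

theorem polarBilin_ne_zero (hψ : ψ ≠ 1) {y : V} (hy : y ≠ 0) : R.polarBilin y ≠ 0 := by
  have hgauss : ∑ y, ∑ x, ψ (1 * R x + polar R x y) = Fintype.card V := by
    simp_rw [hR.sum_addChar_mul_add_polar hψ one_ne_zero, div_one, ← neg_one_mul (R _)]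
    rw [← Finset.mul_sum, hR.sum_addChar_mul hψ (neg_ne_zero.2 one_ne_zero), neg_mul_neg, ← sq,
      ofReal_sqrt_natCast_sq]
  have hradical (x : V) : ∑ y, ψ (1 * R x + polar R x y) =
      if R.polarBilin x = 0 then (Fintype.card V : ℂ) else 0 := by
    simp_rw [AddChar.map_add_eq_mul, ← Finset.mul_sum, ← polarBilin_apply_apply,
      sum_addChar_linearMap hψ]
    split_ifs with hx
    · rw [hR.map_eq_zero_of_polarBilin_eq_zero hψ hx, mul_zero, ψ.map_zero_eq_one, one_mul]
    · rw [mul_zero]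
  rw [Finset.sum_comm, Finset.sum_congr rfl fun x _ => hradical x, ← Finset.sum_filter,
    Finset.sum_const, nsmul_eq_mul] at hgauss
  have hcard : #{x | R.polarBilin x = 0} = 1 := by
    have hV : (Fintype.card V : ℂ) ≠ 0 := Nat.cast_ne_zero.2 Fintype.card_ne_zero
    exact_mod_cast mul_right_cancel₀ hV (hgauss.trans (one_mul _).symm)
  exact fun hy0 => hy (Finset.card_le_one.1 hcard.le y (by simpa using hy0) 0 (by simp))

theorem sum_addChar_polar_eq_zero (hψ : ψ ≠ 1) {y : V} (hy : y ≠ 0) :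
    ∑ x, ψ (polar R x y) = 0 := by
  simp_rw [polar_comm R _ y, ← polarBilin_apply_apply, sum_addChar_linearMap hψ]
  exact if_neg (hR.polarBilin_ne_zero hψ hy)

theorem card_perp_polar_mul_natCard (hψ : ψ ≠ 1) (W : Submodule F V) :
    #{x | x ∈ perp (polar R) W} * Nat.card W = Fintype.card V := by
  have hsum : ∑ x, ∑ w : W, ψ (polar R x w) = Fintype.card V := by
    rw [Finset.sum_comm, Fintype.sum_eq_single 0 fun w hw => hR.sum_addChar_polar_eq_zero hψ
      (Submodule.coe_eq_zero.not.2 hw)]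
    simp
  simp_rw [sum_addChar_polar_submodule hψ] at hsum
  rw [← Finset.sum_filter, Finset.sum_const, nsmul_eq_mul] at hsum
  exact_mod_cast hsum

theorem sum_addChar_mul_add_polar_submodule (hψ : ψ ≠ 1) {W : Submodule F V}
    (hW : ∀ w ∈ W, R w = 0) {s : F} (hs : s ≠ 0) :
    ∑ x, ∑ w : W, ψ (s * R x + polar R x w) = -√(Fintype.card V) * Nat.card W := by
  rw [Finset.sum_comm]
  simp_rw [hR.sum_addChar_mul_add_polar hψ hs, hW _ (Subtype.prop _)]
  simp [mul_comm]

theorem card_singular_perp_polar_mul_natCard [Fintype F] (hψ : ψ ≠ 1) {W : Submodule F V}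
    (hW : ∀ w ∈ W, R w = 0) :
    (Fintype.card F : ℝ) * (#{x | R x = 0 ∧ x ∈ perp (polar R) W} * Nat.card W) =
      Fintype.card V - (Fintype.card F - 1) * (√(Fintype.card V) * Nat.card W) := by
  have hgauss : ∑ s : F with s ≠ 0, ∑ x, ∑ w : W, ψ (s * R x + polar R x w) =
      (Fintype.card F - 1) * (-√(Fintype.card V) * Nat.card W) := by
    rw [Finset.sum_congr rfl fun s hs => hR.sum_addChar_mul_add_polar_submodule hψ hW
      (Finset.mem_filter.1 hs).2, Finset.sum_const, nsmul_eq_mul, Finset.filter_ne',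
      Finset.card_erase_of_mem (Finset.mem_univ _), Finset.card_univ,
      Nat.cast_pred Fintype.card_pos]
  have hcount : ∑ s : F with s ≠ 0, ∑ x, ∑ w : W, ψ (s * R x + polar R x w) =
      Fintype.card F * (#{x | R x = 0 ∧ x ∈ perp (polar R) W} * Nat.card W) -
        #{x | x ∈ perp (polar R) W} * Nat.card W := by
    simp_rw [AddChar.map_add_eq_mul, ← Finset.mul_sum, sum_addChar_polar_submodule hψ]
    rw [Finset.sum_comm]
    simp_rw [← Finset.sum_mul, sum_ne_zero_addChar_mul hψ, sub_mul, one_mul, ite_zero_mul_ite_zero,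
      Finset.sum_sub_distrib, ← Finset.sum_filter, Finset.sum_const, nsmul_eq_mul]
    ring
  have hperp : (#{x | x ∈ perp (polar R) W} * Nat.card W : ℂ) = Fintype.card V := by
    exact_mod_cast hR.card_perp_polar_mul_natCard hψ W
  have hcomplex := hcount.symm.trans hgauss
  rw [hperp] at hcomplex
  have hreal : (Fintype.card F : ℝ) * (#{x | R x = 0 ∧ x ∈ perp (polar R) W} * Nat.card W) -
      Fintype.card V = (Fintype.card F - 1) * (-√(Fintype.card V) * Nat.card W) := by
    exact_mod_cast hcomplex
  linear_combination hreal

end IsMinusType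

end MinusType

section Levels

open QuadraticMap (polar)

open scoped Classical

variable {F V : Type*} [Field F] [Fintype F] [AddCommGroup V] [Module F V] [Fintype V]
  {R : QuadraticForm F V} {ψ : AddChar F ℂ}

theorem kloostermanSum_zero (hψ : ψ ≠ 1) : kloostermanSum ψ 0 = -1 := by
  simpa [kloostermanSum] using sum_ne_zero_addChar_mul hψ 1

theorem norm_kloostermanSum_le (hψ : ψ ≠ 1) (b : F) :
    ‖kloostermanSum ψ b‖ ≤ 2 * √(Fintype.card F) := by
  rcases eq_or_ne b 0 with rfl | hb
  · have hF : 1 ≤ √(Fintype.card F : ℝ) := Real.one_le_sqrt.2 (by exact_mod_cast Fintype.card_pos)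
    rw [kloostermanSum_zero hψ, norm_neg, norm_one]
    linarith
  · exact norm_kloostermanSum_le_of_ne_zero hψ hb

namespace IsMinusType

variable (hR : IsMinusType R) (hψ : ψ ≠ 1) {y : V} (hy : y ≠ 0)
include hR hψ hy

theorem card_mul_sum_addChar_polar_level {t : F} (ht : t ≠ 0) :
    Fintype.card F * ∑ x with R x = t, ψ (polar R x y) =
      -√(Fintype.card V) * kloostermanSum ψ (t * R y) := by
  have hindicator (x : V) : ∑ s, ψ (-t * s) * ψ (s * R x + polar R x y) =
      if R x = t then Fintype.card F * ψ (polar R x y) else 0 := by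
    have hsplit (s : F) : ψ (-t * s) * ψ (s * R x + polar R x y) =
        ψ (s * (R x - t)) * ψ (polar R x y) := by
      rw [← AddChar.map_add_eq_mul, ← AddChar.map_add_eq_mul]
      ring_nf
    simp_rw [hsplit, ← Finset.sum_mul]
    split_ifs with hx
    · simp [hx]
    · rw [sum_addChar_mul_eq_zero hψ (sub_ne_zero.2 hx), zero_mul]
  have hsquare {s : F} (hs : s ≠ 0) : ∑ x, ψ (-t * s) * ψ (s * R x + polar R x y) =
      -√(Fintype.card V) * ψ (-t * s + -R y / s) := by
    rw [← Finset.mul_sum, hR.sum_addChar_mul_add_polar hψ hs, AddChar.map_add_eq_mul, neg_div]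
    ring
  have hzero : ∑ x, ψ (-t * 0) * ψ (0 * R x + polar R x y) = 0 := by
    simpa using hR.sum_addChar_polar_eq_zero hψ hy
  calc Fintype.card F * ∑ x with R x = t, ψ (polar R x y)
    _ = ∑ x, ∑ s, ψ (-t * s) * ψ (s * R x + polar R x y) := by
      rw [Finset.mul_sum, Finset.sum_filter, Finset.sum_congr rfl fun x _ => hindicator x]
    _ = ∑ s with s ≠ 0, ∑ x, ψ (-t * s) * ψ (s * R x + polar R x y) := by
      rw [Finset.sum_comm]
      refine (Finset.sum_filter_of_ne (p := (· ≠ 0)) fun s _ hs hs0 => hs ?_).symm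
      rw [hs0, hzero]
    _ = -√(Fintype.card V) * kloostermanSum ψ (t * R y) := by
      rw [Finset.sum_congr rfl fun s hs => hsquare (Finset.mem_filter.1 hs).2, ← Finset.mul_sum,
        sum_addChar_mul_add_div ψ (neg_ne_zero.2 ht), neg_mul_neg]

theorem card_mul_norm_sum_addChar_polar_le {𝒯 : Finset F} (h𝒯 : 0 ∉ 𝒯) :
    Fintype.card F * ‖∑ x with R x ∈ 𝒯, ψ (polar R x y)‖ ≤
      √(Fintype.card V) * (#𝒯 * (2 * √(Fintype.card F))) := by
  have hsum : Fintype.card F * ∑ x with R x ∈ 𝒯, ψ (polar R x y) =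
      -√(Fintype.card V) * ∑ t ∈ 𝒯, kloostermanSum ψ (t * R y) := by
    rw [Finset.mul_sum 𝒯, ← Finset.sum_congr rfl fun t ht =>
      hR.card_mul_sum_addChar_polar_level hψ hy (ne_of_mem_of_not_mem ht h𝒯), ← Finset.mul_sum]
    simp_rw [Finset.sum_filter]
    rw [Finset.sum_comm]
    simp_rw [Finset.sum_ite_eq]
  have hnorm := congrArg norm hsum
  rw [norm_mul, norm_mul, norm_neg, Complex.norm_natCast, Complex.norm_real,
    Real.norm_of_nonneg (Real.sqrt_nonneg _)] at hnorm
  rw [hnorm]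
  gcongr
  rw [← nsmul_eq_mul]
  exact norm_sum_le_of_le _ (fun t _ => norm_kloostermanSum_le hψ _) |>.trans_eq
    (Finset.sum_const _)

end IsMinusType

end Levels

section Points

open scoped LinearAlgebra.Projectivization

variable {K V : Type*} [Field K] [AddCommGroup V] [Module K V]

theorem smul_rep_injective : Function.Injective fun z : ℙ K V × Kˣ => z.2 • z.1.rep := by
  rintro ⟨p, c⟩ ⟨p', c'⟩ heq
  obtain rfl : p = p' := by
    rw [← p.mk_rep, ← p'.mk_rep, Projectivization.mk_eq_mk_iff]
    exact ⟨c⁻¹ * c', by rw [mul_smul, ← show c • p.rep = c' • p'.rep from heq, inv_smul_smul]⟩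
  exact Prod.ext rfl (Units.ext (smul_left_injective K p.rep_nonzero heq))

theorem ncard_mk_mem (A : Set (ℙ K V)) :
    {x | ∃ hx : x ≠ 0, Projectivization.mk K x hx ∈ A}.ncard = A.ncard * (Nat.card K - 1) := by
  have himage : {x | ∃ hx : x ≠ 0, Projectivization.mk K x hx ∈ A} =
      (fun z : ℙ K V × Kˣ => z.2 • z.1.rep) '' (A ×ˢ Set.univ) := by
    ext x
    constructor
    · rintro ⟨hx, hxA⟩
      obtain ⟨c, hc⟩ := Projectivization.exists_smul_eq_mk_rep K x hx
      exact ⟨(_, c⁻¹), ⟨hxA, trivial⟩, inv_smul_eq_iff.2 hc.symm⟩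
    · rintro ⟨⟨p, c⟩, ⟨hp, -⟩, rfl⟩
      have hcp : c • p.rep ≠ 0 := (smul_ne_zero_iff_ne c).2 p.rep_nonzero
      refine ⟨hcp, ?_⟩
      rwa [← (Projectivization.mk_eq_mk_iff K p.rep (c • p.rep) p.rep_nonzero hcp).2
        ⟨c⁻¹, inv_smul_smul c _⟩, p.mk_rep]
  rw [himage, Set.ncard_image_of_injective _ smul_rep_injective, Set.ncard_prod, Set.ncard_univ,
    Nat.card_units]

theorem mk_mem_pointsWithValueIn {E : Type*} {R : V → E} {𝒯 : Set E}
    (hsmul : ∀ c : K, c ≠ 0 → ∀ x, R x ∈ 𝒯 → R (c • x) ∈ 𝒯) {x : V} (hx : x ≠ 0) :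
    Projectivization.mk K x hx ∈ pointsWithValueIn K R 𝒯 ↔ R x ∈ 𝒯 := by
  refine ⟨fun ⟨v, hv, hRv, hxv⟩ => ?_, fun hRx => ⟨x, hx, hRx, rfl⟩⟩
  obtain ⟨c, rfl⟩ := (Projectivization.mk_eq_mk_iff K x v hx hv).1 hxv
  exact hsmul c c.ne_zero v hRv

namespace IsMOvoid

variable {E : Type*} {S : Submodule K V → Prop} {m : ℕ} {R : V → E} {𝒯 : Set E}
  (hM : IsMOvoid S m (pointsWithValueIn K R 𝒯)) (hR0 : R 0 ∉ 𝒯)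
include hM hR0

theorem span_singleton {x : V} (hx : R x ∈ 𝒯) : S (K ∙ x) := by
  have hx0 : x ≠ 0 := by
    rintro rfl
    exact hR0 hx
  rw [← Projectivization.submodule_mk x hx0]
  exact hM.1 _ ⟨x, hx0, hx, rfl⟩

theorem ncard_mem_of_maximal (hsmul : ∀ c : K, c ≠ 0 → ∀ x, R x ∈ 𝒯 → R (c • x) ∈ 𝒯)
    {W : Submodule K V} (hW : Maximal S W) :
    {x | R x ∈ 𝒯 ∧ x ∈ W}.ncard = m * (Nat.card K - 1) := by
  rw [← hM.2 W hW, ← ncard_mk_mem]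
  congr 1
  ext x
  simp only [Set.mem_ofPred_eq, mk_mem_pointsWithValueIn hsmul, Projectivization.submodule_mk,
    Submodule.span_singleton_le_iff_mem]
  exact ⟨fun hx => ⟨fun hx0 => hR0 (hx0 ▸ hx.1), hx⟩, fun ⟨_, hx⟩ => hx⟩

end IsMOvoid

end Points

section Cosets

variable {K E : Type*} [Field K] [Field E] [Algebra K E]

theorem IsCosetReps.ncard_eq {G : Set K} {𝒯 : Set E} {T : Finset E}
    (h : IsCosetReps G 𝒯 T) (h𝒯 : IsInvariantSet G 𝒯) : 𝒯.ncard = #T * G.ncard := by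
  have himage : (fun z : E × K => z.2 • z.1) '' ((T : Set E) ×ˢ G) = 𝒯 := by
    ext x
    constructor
    · rintro ⟨⟨t, c⟩, ⟨ht, hc⟩, rfl⟩
      exact h𝒯.2 c hc t (h.1 t ht)
    · intro hx
      obtain ⟨t, ⟨ht, c, hc, rfl⟩, _⟩ := h.2 x hx
      exact ⟨(t, c), ⟨ht, hc⟩, rfl⟩
  have hinj : Set.InjOn (fun z : E × K => z.2 • z.1) ((T : Set E) ×ˢ G) := by
    rintro ⟨t, c⟩ ⟨ht, hc⟩ ⟨t', c'⟩ ⟨ht', hc'⟩ heq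
    obtain rfl : t = t' := (h.2 (c • t) (h𝒯.2 c hc t (h.1 t ht))).unique
      ⟨ht, c, hc, rfl⟩ ⟨ht', c', hc', heq⟩
    exact Prod.ext rfl (smul_left_injective K (h𝒯.1 t (h.1 t ht)) heq)
  rw [← himage, hinj.ncard_image, Set.ncard_prod, Set.ncard_coe_finset]

variable (K) [Finite K]

theorem cast_natCard_sub_one : ((Nat.card K - 1 : ℕ) : ℝ) = Nat.card K - 1 :=
  Nat.cast_pred Nat.card_pos

theorem ncard_nonzeroElements : ((nonzeroElements K).ncard : ℝ) = Nat.card K - 1 := by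
  have hcompl : nonzeroElements K = {0}ᶜ := rfl
  rw [hcompl, Set.ncard_compl, Set.ncard_singleton, cast_natCard_sub_one]

theorem ncard_nonzeroSquares :
    ((nonzeroSquares K).ncard : ℝ) = epsilon (Nat.card K) * (Nat.card K - 1) := by
  have hrange : nonzeroSquares K = Units.val '' ((powMonoidHom 2 : Kˣ →* Kˣ).range : Set Kˣ) := by
    ext c
    constructor
    · rintro ⟨hc, r, rfl⟩
      exact ⟨_, ⟨Units.mk0 r (left_ne_zero_of_mul hc), rfl⟩, by simp [sq]⟩
    · rintro ⟨_, ⟨u, rfl⟩, rfl⟩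
      exact ⟨Units.ne_zero _, u, by simp [sq]⟩
  rw [hrange, Set.ncard_image_of_injective _ Units.val_injective, ← Nat.card_coe_set_eq,
    SetLike.coe_sort_coe, IsCyclic.card_powMonoidHom_range, Nat.card_units, epsilon,
    ← cast_natCard_sub_one K]
  have hK : 0 < Nat.card K := Nat.card_pos
  split_ifs with hodd
  · have heven : 2 ∣ Nat.card K - 1 := (Nat.Odd.sub_odd hodd odd_one).two_dvd
    rw [Nat.gcd_eq_right heven, Nat.cast_div heven two_ne_zero]
    ring
  · have hodd' : Odd (Nat.card K - 1) := Nat.Even.sub_odd hK (Nat.not_odd_iff_even.1 hodd) odd_one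
    rw [Nat.coprime_two_right.2 hodd', Nat.div_one, one_mul]

end Cosets

section Ovoids

open QuadraticMap (polar)

theorem exists_addChar_ne_one (K : Type*) [Field K] [Finite K] : ∃ ψ : AddChar K ℂ, ψ ≠ 1 := by
  obtain ⟨ψ, h⟩ := AddChar.exists_apply_ne_zero.2 (one_ne_zero (α := K))
  exact ⟨ψ, AddChar.ne_one_iff.2 ⟨1, h⟩⟩

section

variable {K F V : Type*} [Field K] [Field F] [AddCommGroup V] [Module K V]
  [Module F V] [Fintype V] {β : V → V → K} {P : V → Prop} {ρ : ℝ} {R : QuadraticForm F V}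
  {ψ : AddChar F ℂ} {χ : AddChar K ℂ} {θ : V → V}

open scoped Classical in
theorem card_le_of_card_maximal [Finite K] [Fintype F] (h : IsPolarForm β P) (hρ : 0 < ρ)
    (hcount : HasMinusPerpCounts β P ρ) (hR : IsMinusType R) (hψ : ψ ≠ 1) (hχ : χ ≠ 1)
    (hθ : ∀ x, x ≠ 0 → θ x ≠ 0) (hβ : ∀ x y, χ (β x y) = ψ (polar R x (θ y))) {𝒯 : Finset F}
    (h𝒯 : 0 ∉ 𝒯) (hne : 𝒯.Nonempty) (hP : ∀ x, R x ∈ 𝒯 → P x)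
    (hsmul : ∀ c : K, c ≠ 0 → ∀ x, R x ∈ 𝒯 → R (c • x) ∈ 𝒯)
    (hN : ∀ W, Maximal (TotallyPolar β P) W →
      (#{x | R x ∈ 𝒯 ∧ x ∈ W} : ℝ) * Fintype.card F = √(Fintype.card V) * #𝒯) :
    (Fintype.card F : ℝ) ≤ #𝒯 * (2 * √(Fintype.card F) + 1) := by
  set D : Finset V := {x | R x ∈ 𝒯} with hD
  set N : ℝ := √(Fintype.card V) * #𝒯 / Fintype.card F with hNdef
  have hF : (0 : ℝ) < Fintype.card F := by exact_mod_cast Fintype.card_pos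
  have hV : 0 < √(Fintype.card V : ℝ) := Real.sqrt_pos.2 (by exact_mod_cast Fintype.card_pos)
  have hD0 : (0 : V) ∉ D := by simpa [hD] using h𝒯
  have hDP : ∀ x ∈ D, P x := by simpa [hD] using hP
  have hDsmul : ∀ c : K, c ≠ 0 → ∀ x ∈ D, c • x ∈ D := by simpa [hD] using hsmul
  have hDN (W) (hW : Maximal (TotallyPolar β P) W) : (#{x ∈ D | x ∈ W} : ℝ) = N := by
    rw [hNdef, eq_div_iff hF.ne', ← hN W hW, Finset.filter_filter]
  obtain ⟨z, hz⟩ : D.Nonempty := by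
    rw [← Finset.card_pos, ← Nat.cast_pos (α := ℝ),
      card_eq_of_card_maximal h hρ hcount hDP hD0 hDN]
    have : (0 : ℝ) < #𝒯 := by exact_mod_cast hne.card_pos
    positivity
  have hcoeff := sum_addChar_of_card_maximal h hρ hcount hDP hD0 hDN hDsmul hχ hz
  have hweil := hR.card_mul_norm_sum_addChar_polar_le hψ (hθ z (ne_of_mem_of_not_mem hz hD0)) h𝒯
  simp_rw [hβ] at hcoeff
  rw [hcoeff, Complex.norm_real, Real.norm_eq_abs] at hweil
  have hbound : √(Fintype.card V : ℝ) * (Fintype.card F - #𝒯) ≤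
      √(Fintype.card V) * (#𝒯 * (2 * √(Fintype.card F))) := by
    refine le_trans (le_of_eq ?_) ((mul_le_mul_of_nonneg_left (neg_le_abs _) hF.le).trans hweil)
    rw [hNdef]
    field_simp
    ring
  linarith [le_of_mul_le_mul_left hbound hV]

theorem IsMOvoid.card_le [Finite K] [Finite F] {S : Submodule K V → Prop} (h : IsPolarForm β P)
    (hS : ∀ W, S W ↔ TotallyPolar β P W) (hρ : 0 < ρ) (hcount : HasMinusPerpCounts β P ρ)
    (hR : IsMinusType R) (hψ : ψ ≠ 1) (hχ : χ ≠ 1) (hθ : ∀ x, x ≠ 0 → θ x ≠ 0)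
    (hβ : ∀ x y, χ (β x y) = ψ (polar R x (θ y))) {m : ℕ} {𝒯 : Set F} (h𝒯 : 0 ∉ 𝒯)
    (hne : 𝒯.Nonempty) (hsmul : ∀ c : K, c ≠ 0 → ∀ x, R x ∈ 𝒯 → R (c • x) ∈ 𝒯)
    (hm : (m * (Nat.card K - 1) * Nat.card F : ℝ) = √(Fintype.card V) * 𝒯.ncard)
    (hM : IsMOvoid S m (pointsWithValueIn K R 𝒯)) :
    (Nat.card F : ℝ) ≤ 𝒯.ncard * (2 * √(Nat.card F) + 1) := by
  classical
  have := Fintype.ofFinite F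
  obtain rfl : S = TotallyPolar β P := funext fun W => propext (hS W)
  have hR0 : R 0 ∉ 𝒯 := by rwa [QuadraticMap.map_zero]
  rw [Set.ncard_eq_toFinset_card'] at hm ⊢
  rw [Nat.card_eq_fintype_card (α := F)] at hm ⊢
  refine card_le_of_card_maximal (𝒯 := 𝒯.toFinset) h hρ hcount hR hψ hχ hθ hβ (by simpa using h𝒯)
    (by simpa using hne) (fun x hx => ?_) (by simpa using hsmul) fun W hW => ?_
  · exact (hM.span_singleton hR0 (Set.mem_toFinset.1 hx)
      (Submodule.mem_span_singleton_self x)).1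
  · rw [← hm, ← cast_natCard_sub_one K, ← Nat.cast_mul m, ← hM.ncard_mem_of_maximal hR0 hsmul hW,
      ← Set.ncard_coe_finset]
    simp

end

section

variable {K₀ K V : Type*} [Field K₀] [Field K] [Finite K₀] [Finite K] [Algebra K₀ K]

theorem eq_zero_of_trace_mul_eq_zero {a : K} (h : ∀ c : K, Algebra.trace K₀ K (c * a) = 0) :
    a = 0 :=
  (traceForm_nondegenerate K₀ K).2 a h

variable [AddCommGroup V] [Module K₀ V] [Module K V] [IsScalarTower K₀ K V] {β : V → V → K}
  {P : V → Prop} {Q : QuadraticForm K₀ V}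

theorem IsPolarForm.perp_eq_perp_polar (h : IsPolarForm β P)
    (hβ : ∀ x y, polar Q x y = Algebra.trace K₀ K (β x y)) (W : Submodule K V) :
    perp β W = perp (polar Q) (W.restrictScalars K₀) := by
  ext x
  refine ⟨fun hx w hw => by rw [hβ, hx w hw, map_zero], fun hx w hw =>
    h.refl _ _ (eq_zero_of_trace_mul_eq_zero (K₀ := K₀) fun c => ?_)⟩
  rw [← h.smul_left, ← hβ, QuadraticMap.polar_comm]
  exact hx _ (W.smul_mem c hw)

theorem IsPolarForm.hasMinusPerpCounts [Fintype V] (h : IsPolarForm β (Q · = 0))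
    (hQ : IsMinusType Q) (hβ : ∀ x y, polar Q x y = Algebra.trace K₀ K (β x y)) :
    HasMinusPerpCounts β (Q · = 0) (Nat.card K₀) := by
  classical
  have := Fintype.ofFinite K₀
  obtain ⟨χ, hχ⟩ := exists_addChar_ne_one K₀
  intro W hW
  have hfilter : ({x | x ∈ isotropicPerp β (Q · = 0) W} : Finset V) =
      ({x | Q x = 0 ∧ x ∈ perp (polar Q) (W.restrictScalars K₀)} : Finset V) :=
    Finset.filter_congr fun x _ => by
      rw [← h.perp_eq_perp_polar hβ]
      rfl
  rw [Nat.card_eq_fintype_card (α := K₀), hfilter]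
  exact hQ.card_singular_perp_polar_mul_natCard hχ fun w hw => (hW hw).1

end

section Quadratic

variable {K V : Type*} [Field K] [AddCommGroup V] [Module K V]

theorem isPolarForm_polar (Q : QuadraticForm K V) : IsPolarForm (polar Q) (Q · = 0) where
  add_left := Q.polar_add_left
  smul_left := Q.polar_smul_left
  refl x y hxy := by rwa [QuadraticMap.polar_comm]
  zero := Q.map_zero
  smul c x hx := by rw [Q.map_smul, hx, smul_zero]
  add x y hx hy hxy := by rw [QuadraticMap.map_add Q, hx, hy, hxy, add_zero, add_zero]
  self x hx := by rw [QuadraticMap.polar_self, hx, smul_zero]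

theorem totallySingular_iff_totallyPolar (Q : QuadraticForm K V) (W : Submodule K V) :
    TotallySingular Q W ↔ TotallyPolar (polar Q) (Q · = 0) W := by
  refine ⟨fun hW x hx => ⟨hW x hx, fun y hy => ?_⟩, fun hW x hx => (hW hx).1⟩
  rw [QuadraticMap.polar, hW _ (W.add_mem hx hy), hW x hx, hW y hy, sub_zero, sub_zero]

variable {F : Type*} [Field F] [Algebra K F] [Module F V] [IsScalarTower K F V]

/-- The quadratic form `Tr ∘ R` over a subfield. -/
def traceQuadraticForm (K : Type*) {F V : Type*} [Field K] [Field F] [Algebra K F] [AddCommGroup V]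
    [Module K V] [Module F V] [IsScalarTower K F V] (R : QuadraticForm F V) : QuadraticForm K V :=
  (Algebra.trace K F).compQuadraticMap' R

theorem traceQuadraticForm_apply (R : QuadraticForm F V) (x : V) :
    traceQuadraticForm K R x = Algebra.trace K F (R x) := rfl

theorem polar_traceQuadraticForm (R : QuadraticForm F V) (x y : V) :
    polar (traceQuadraticForm K R) x y = Algebra.trace K F (polar R x y) :=
  LinearMap.compQuadraticMap_polar _ _ _ _

variable [Finite F] [Fintype V] {R : QuadraticForm F V}

theorem IsMinusType.traceQuadraticForm (hR : IsMinusType R) :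
    IsMinusType (traceQuadraticForm K R) :=
  fun _ hψ => hR _ (traceChar_ne_one hψ)

theorem IsMOvoid.card_le_of_totallySingular [Finite K] (hR : IsMinusType R) {m : ℕ} {𝒯 : Set F}
    (hne : 𝒯.Nonempty) (h𝒯 : IsInvariantSet (nonzeroSquares K) 𝒯)
    (hm : (m * (Nat.card K - 1) * Nat.card F : ℝ) = √(Fintype.card V) * 𝒯.ncard)
    (hM : IsMOvoid (TotallySingular fun x => Algebra.trace K F (R x)) m
      (pointsWithValueIn K R 𝒯)) :
    (Nat.card F : ℝ) ≤ 𝒯.ncard * (2 * √(Nat.card F) + 1) := by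
  obtain ⟨χ, hχ⟩ := exists_addChar_ne_one K
  refine hM.card_le (θ := id) (isPolarForm_polar (traceQuadraticForm K R))
    (totallySingular_iff_totallyPolar _) (by exact_mod_cast Nat.card_pos)
    ((isPolarForm_polar _).hasMinusPerpCounts hR.traceQuadraticForm fun x y =>
      (Algebra.trace_self_apply _).symm) hR (traceChar_ne_one hχ) hχ (fun _ => id)
    (fun x y => ?_) (fun h0 => h𝒯.1 0 h0 rfl) hne (fun c hc x hx => ?_) hm
  · rw [id, polar_traceQuadraticForm, traceChar_apply]
  · rw [← algebraMap_smul F c x, R.map_smul, ← map_mul, algebraMap_smul]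
    exact h𝒯.2 _ ⟨mul_ne_zero hc hc, c, rfl⟩ _ hx

end Quadratic

end Ovoids

section GaussSums

theorem sum_addChar_mul_eq_card {F : Type*} [Field F] [Fintype F] {ψ : AddChar F ℂ} (hψ : ψ ≠ 1) :
    ∑ u : F × F, ψ (u.1 * u.2) = Fintype.card F := by
  classical
  rw [Fintype.sum_prod_type_right,
    Fintype.sum_eq_single 0 fun b hb => sum_addChar_mul_eq_zero hψ hb]
  simp

theorem sum_addChar_norm {F E : Type*} [Field F] [Fintype F] [Field E] [Fintype E] [Algebra F E]
    (h : Module.finrank F E = 2) {ψ : AddChar F ℂ} (hψ : ψ ≠ 1) :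
    ∑ x : E, ψ (Algebra.norm F x) = -Fintype.card F := by
  classical
  have hsplit := sum_add_mul_add_sum_trace_norm h fun p : F × F => ψ p.2
  have hψ0 : ∑ x, ψ x = 0 := AddChar.sum_eq_zero_of_ne_one hψ
  rw [sum_addChar_mul_eq_card hψ, Fintype.sum_prod_type] at hsplit
  simp only [hψ0, Finset.sum_const_zero, mul_zero] at hsplit
  linear_combination hsplit

theorem sum_addChar_sum {F ι X : Type*} [Field F] [Fintype ι] [DecidableEq ι] [Fintype X]
    (ψ : AddChar F ℂ) (g : ι → X → F) :
    ∑ x : ι → X, ψ (∑ i, g i (x i)) = ∏ i, ∑ a, ψ (g i a) := by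
  rw [Finset.prod_univ_sum, Fintype.piFinset_univ]
  exact Finset.sum_congr rfl fun x _ => map_prod ψ.toMonoidHom _ _

end GaussSums

section HermitianForm

open QuadraticMap (polar)

variable (L₀ : Type*) {L : Type*} [Field L] {n : ℕ}

theorem hermForm_add_left (x y z : Fin n → L) :
    hermForm L₀ (x + y) z = hermForm L₀ x z + hermForm L₀ y z := by
  simp [hermForm, add_mul, Finset.sum_add_distrib]

theorem hermForm_smul_left (c : L) (x y : Fin n → L) :
    hermForm L₀ (c • x) y = c * hermForm L₀ x y := by
  simp [hermForm, Finset.mul_sum, mul_assoc]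

theorem hermForm_smul_right (c : L) (x y : Fin n → L) :
    hermForm L₀ x (c • y) = c ^ Nat.card L₀ * hermForm L₀ x y := by
  simp [hermForm, Finset.mul_sum, mul_pow, mul_left_comm]

variable {L₀} [Field L₀] [Algebra L₀ L]

theorem hermNorm_smul (c : L) (x : Fin n → L) :
    hermNorm L₀ (c • x) = Algebra.norm L₀ c * hermNorm L₀ x := by
  simp [hermNorm, Finset.mul_sum]

theorem pow_natCard_pow_natCard [Finite L] (h : Module.finrank L₀ L = 2) (x : L) :
    (x ^ Nat.card L₀) ^ Nat.card L₀ = x := by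
  have := Fintype.ofFinite L
  rw [← pow_mul, ← sq, ← h, ← Module.natCard_eq_pow_finrank, Nat.card_eq_fintype_card,
    FiniteField.pow_card]

theorem sqrt_card_pi_of_finrank_two [Fintype L] (h : Module.finrank L₀ L = 2) (n : ℕ) :
    √(Fintype.card (Fin n → L)) = (Nat.card L₀ : ℝ) ^ n := by
  rw [Fintype.card_fun, Fintype.card_fin, ← Nat.card_eq_fintype_card (α := L),
    Module.natCard_eq_pow_finrank (K := L₀), h, pow_right_comm, Nat.cast_pow, Nat.cast_pow,
    Real.sqrt_sq (by positivity)]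

variable (L₀) [Finite L₀]

theorem add_pow_natCard (x y : L) : (x + y) ^ Nat.card L₀ = x ^ Nat.card L₀ + y ^ Nat.card L₀ := by
  have := Fintype.ofFinite L₀
  rw [Nat.card_eq_fintype_card]
  exact map_add (FiniteField.frobeniusAlgHom L₀ L) x y

theorem sum_pow_natCard {ι : Type*} (s : Finset ι) (x : ι → L) :
    (∑ i ∈ s, x i) ^ Nat.card L₀ = ∑ i ∈ s, x i ^ Nat.card L₀ := by
  have := Fintype.ofFinite L₀
  rw [Nat.card_eq_fintype_card]
  exact map_sum (FiniteField.frobeniusAlgHom L₀ L) x s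

theorem hermForm_add_right (x y z : Fin n → L) :
    hermForm L₀ x (y + z) = hermForm L₀ x y + hermForm L₀ x z := by
  simp [hermForm, add_pow_natCard, mul_add, Finset.sum_add_distrib]

variable {L₀} (h : Module.finrank L₀ L = 2)
include h

theorem hermForm_swap [Finite L] (x y : Fin n → L) :
    hermForm L₀ y x = hermForm L₀ x y ^ Nat.card L₀ := by
  simp [hermForm, sum_pow_natCard, mul_pow, pow_natCard_pow_natCard h, mul_comm]

theorem algebraMap_trace_natCard [Finite L] (x : L) :
    algebraMap L₀ L (Algebra.trace L₀ L x) = x + x ^ Nat.card L₀ := by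
  have := Fintype.ofFinite L₀
  rw [Nat.card_eq_fintype_card, algebraMap_trace_of_finrank_two h]

theorem polar_hermNorm [Finite L] (x y : Fin n → L) :
    polar (hermNorm L₀) x y = Algebra.trace L₀ L (hermForm L₀ x y) := by
  apply (algebraMap L₀ L).injective
  rw [QuadraticMap.polar, map_sub, map_sub, algebraMap_hermNorm L₀ h, algebraMap_hermNorm L₀ h,
    algebraMap_hermNorm L₀ h, algebraMap_trace_natCard h, ← hermForm_swap h, hermForm_add_left,
    hermForm_add_right, hermForm_add_right]
  ring

/-- `hermNorm L₀` as a quadratic form over `L₀`. -/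
def hermNormForm [Finite L] (n : ℕ) : QuadraticForm L₀ (Fin n → L) :=
  QuadraticMap.ofPolar (hermNorm L₀)
    (fun c x => by
      rw [← algebraMap_smul L c x, hermNorm_smul, Algebra.norm_algebraMap, h, sq, smul_eq_mul])
    (fun x y z => by
      rw [polar_hermNorm h, polar_hermNorm h, polar_hermNorm h, hermForm_add_left, map_add])
    (fun c x y => by
      rw [polar_hermNorm h, polar_hermNorm h, ← algebraMap_smul L c x, hermForm_smul_left,
        ← Algebra.smul_def, map_smul])

theorem coe_hermNormForm [Finite L] (n : ℕ) : ⇑(hermNormForm h n) = hermNorm L₀ := rfl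

theorem isMinusType_hermNormForm [Fintype L] (hn : Odd n) :
    IsMinusType (hermNormForm h n) := by
  intro ψ hψ
  have := Fintype.ofFinite L₀
  refine (sum_addChar_sum ψ fun _ : Fin n => Algebra.norm L₀).trans ?_
  rw [sqrt_card_pi_of_finrank_two h]
  simp [sum_addChar_norm h hψ, hn.neg_pow]

end HermitianForm

section Elliptic

theorem sqrt_card_pi_two_mul_add_two (L : Type*) [Fintype L] (k : ℕ) :
    √(Fintype.card (Fin (2 * k + 2) → L)) = (Nat.card L : ℝ) ^ (k + 1) := by
  rw [Fintype.card_fun, Fintype.card_fin, ← Nat.card_eq_fintype_card, ← mul_add_one, pow_mul',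
    Nat.cast_pow, Nat.cast_pow, Real.sqrt_sq (by positivity)]

variable {L : Type*} [Field L] {k : ℕ}

/-- `ellipticForm a₀ a₁` as a `QuadraticForm`. -/
def ellipticQuadraticForm (k : ℕ) (a₀ a₁ : L) : QuadraticForm L (Fin (2 * k + 2) → L) :=
  ∑ i : Fin k, QuadraticMap.linMulLin (LinearMap.proj ⟨2 * i, by omega⟩)
      (LinearMap.proj ⟨2 * i + 1, by omega⟩) +
    (QuadraticMap.proj ⟨2 * k, by omega⟩ ⟨2 * k, by omega⟩ +
      a₀ • QuadraticMap.proj ⟨2 * k, by omega⟩ ⟨2 * k + 1, by omega⟩ +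
      a₁ • QuadraticMap.proj ⟨2 * k + 1, by omega⟩ ⟨2 * k + 1, by omega⟩)

theorem coe_ellipticQuadraticForm (a₀ a₁ : L) :
    ⇑(ellipticQuadraticForm k a₀ a₁) = ellipticForm a₀ a₁ := by
  ext x
  simp [ellipticQuadraticForm, ellipticForm, sq, mul_assoc]

/-- The pairs of coordinates of a vector in `L ^ (2k + 2)`. -/
def coordinatePairs (L : Type*) (k : ℕ) : (Fin (2 * k + 2) → L) ≃ (Fin (k + 1) → L × L) where
  toFun x i := (x ⟨2 * i, by omega⟩, x ⟨2 * i + 1, by omega⟩)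
  invFun y j := if (j : ℕ) % 2 = 0 then (y ⟨j / 2, by omega⟩).1 else (y ⟨j / 2, by omega⟩).2
  left_inv x := by
    ext j
    dsimp only
    split_ifs with h
    · congr 1; ext; simp only; omega
    · congr 1; ext; simp only; omega
  right_inv y := by
    ext i
    · simp
    · have : (2 * (i : ℕ) + 1) / 2 = i := by omega
      simp [this]

theorem natDegree_X_sq_add_C_mul_X_add_C (a₀ a₁ : L) :
    (X ^ 2 + C a₀ * X + C a₁ : L[X]).natDegree = 2 := by
  compute_degree!

theorem sum_addChar_anisotropic [Fintype L] {a₀ a₁ : L}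
    (h : Irreducible (X ^ 2 + C a₀ * X + C a₁ : L[X])) {ψ : AddChar L ℂ} (hψ : ψ ≠ 1) :
    ∑ p : L × L, ψ (p.1 ^ 2 + a₀ * p.1 * p.2 + a₁ * p.2 ^ 2) = -Fintype.card L := by
  have : Fact (∀ r : L, r ^ 2 ≠ -a₁ + a₀ * r) := ⟨fun r hr => by
    refine h.not_isRoot_of_natDegree_ne_one (x := -r) ?_ ?_
    · rw [natDegree_X_sq_add_C_mul_X_add_C]
      decide
    · simp only [IsRoot.def, eval_add, eval_pow, eval_X, eval_mul, eval_C]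
      linear_combination hr⟩
  have := Fintype.ofEquiv _ (QuadraticAlgebra.equivProd (-a₁) a₀).symm
  have hnorm (z : QuadraticAlgebra L (-a₁) a₀) : Algebra.norm L z = QuadraticAlgebra.norm z := by
    rw [← QuadraticAlgebra.det_toLinearMap_eq_norm, Algebra.norm_apply]
    rfl
  rw [← sum_addChar_norm (QuadraticAlgebra.finrank_eq_two (-a₁) a₀) hψ,
    ← Equiv.sum_comp (QuadraticAlgebra.equivProd (-a₁) a₀)]
  refine Finset.sum_congr rfl fun z _ => ?_
  rw [hnorm, QuadraticAlgebra.norm_def, QuadraticAlgebra.equivProd, Equiv.coe_fn_mk]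
  ring_nf

theorem isMinusType_ellipticQuadraticForm [Fintype L] {a₀ a₁ : L}
    (h : Irreducible (X ^ 2 + C a₀ * X + C a₁ : L[X])) :
    IsMinusType (ellipticQuadraticForm k a₀ a₁) := by
  intro ψ hψ
  let g : Fin (k + 1) → L × L → L := Fin.lastCases
    (fun p => p.1 ^ 2 + a₀ * p.1 * p.2 + a₁ * p.2 ^ 2) (fun _ p => p.1 * p.2)
  have hsplit (x : Fin (2 * k + 2) → L) :
      ellipticForm a₀ a₁ x = ∑ i, g i (coordinatePairs L k x i) := by
    rw [Fin.sum_univ_castSucc]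
    simp [g, coordinatePairs, ellipticForm]
  simp_rw [coe_ellipticQuadraticForm, hsplit]
  rw [Equiv.sum_comp (coordinatePairs L k) fun y => ψ (∑ i, g i (y i)), sum_addChar_sum,
    Fin.prod_univ_castSucc, sqrt_card_pi_two_mul_add_two]
  simp only [g, Fin.lastCases_castSucc, Fin.lastCases_last, sum_addChar_mul_eq_card hψ,
    sum_addChar_anisotropic h hψ]
  simp [pow_succ]

end Elliptic

section HermitianTower

open QuadraticMap (polar)

variable {K L₀ L : Type*} [Field K] [Field L₀] [Field L] [Finite L₀] [Finite L]
  [Algebra K L₀] [Algebra K L] [Algebra L₀ L] [IsScalarTower K L₀ L] {n : ℕ}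
  (h : Module.finrank L₀ L = 2)

theorem polar_traceQuadraticForm_hermNormForm (x y : Fin n → L) :
    polar (traceQuadraticForm K (hermNormForm h n)) x y = Algebra.trace K L (hermForm L₀ x y) := by
  rw [polar_traceQuadraticForm, coe_hermNormForm, polar_hermNorm h, Algebra.trace_trace]

theorem trace_hermForm_smul_left {K L : Type*} (L₀ : Type*) [Field K] [Field L] [Algebra K L]
    (c : K) (x y : Fin n → L) :
    Algebra.trace K L (hermForm L₀ (c • x) y) = c * Algebra.trace K L (hermForm L₀ x y) := by
  rw [← algebraMap_smul L c x, hermForm_smul_left, ← Algebra.smul_def, map_smul, smul_eq_mul]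

include h in
theorem hermNorm_smul_of_tower (c : K) (x : Fin n → L) :
    hermNorm L₀ (c • x) = (c * c) • hermNorm L₀ x := by
  rw [← coe_hermNormForm h, ← algebraMap_smul L₀ c x, QuadraticMap.map_smul, ← map_mul,
    algebraMap_smul]

end HermitianTower

section Symplectic

open QuadraticMap (polar)

variable {K L₀ L : Type*} [Field K] [Field L₀] [Field L] [Finite L₀] [Finite L]
  [Algebra K L₀] [Algebra K L] [Algebra L₀ L] [IsScalarTower K L₀ L] {n : ℕ}
  (h : Module.finrank L₀ L = 2)

theorem hasMinusPerpCounts_of_eq_polar [Finite K] {V : Type*} [AddCommGroup V] [Module K V]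
    [Fintype V] {Q : QuadraticForm K V} (hQ : IsMinusType Q) {β : V → V → K} {θ : V →ₗ[K] V}
    (hθ : Function.Injective θ) (hβ : ∀ x y, β x y = polar Q x (θ y)) :
    HasMinusPerpCounts β (fun _ => True) 1 := by
  classical
  obtain ⟨χ, hχ⟩ := exists_addChar_ne_one K
  intro W _
  have hperp : ∀ x, x ∈ isotropicPerp β (fun _ => True) W ↔ x ∈ perp (polar Q) (W.map θ) := by
    simp [isotropicPerp, perp, hβ]
  have hcount := hQ.card_perp_polar_mul_natCard hχ (W.map θ)
  rw [Nat.card_congr (W.equivMapOfInjective θ hθ).toEquiv.symm] at hcount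
  simp_rw [hperp]
  rw [one_mul, sub_self, zero_mul, sub_zero]
  exact_mod_cast hcount

section

variable {lam : L} (hlam : lam + lam ^ Nat.card L₀ = 0)
include h hlam

theorem trace_mul_hermForm_swap (x y : Fin n → L) :
    Algebra.trace L₀ L (lam * hermForm L₀ y x) = -Algebra.trace L₀ L (lam * hermForm L₀ x y) := by
  apply (algebraMap L₀ L).injective
  rw [map_neg, algebraMap_trace_natCard h, algebraMap_trace_natCard h, mul_pow, mul_pow,
    ← hermForm_swap h, ← hermForm_swap h]
  linear_combination (hermForm L₀ x y + hermForm L₀ y x) * hlam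

theorem trace_mul_hermForm_self (x : Fin n → L) :
    Algebra.trace L₀ L (lam * hermForm L₀ x x) = 0 := by
  apply (algebraMap L₀ L).injective
  rw [map_zero, algebraMap_trace_natCard h, mul_pow, ← hermForm_swap h]
  linear_combination hermForm L₀ x x * hlam

theorem isPolarForm_trace_mul_hermForm : IsPolarForm
    (fun x y : Fin n → L => Algebra.trace K L (lam * hermForm L₀ x y)) fun _ => True where
  add_left x y z := by rw [hermForm_add_left, mul_add, map_add]
  smul_left c x z := by
    rw [← algebraMap_smul L c x, hermForm_smul_left, mul_left_comm, ← Algebra.smul_def, map_smul,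
      smul_eq_mul]
  refl x y hxy := by
    rw [← Algebra.trace_trace (S := L₀)] at hxy ⊢
    rw [trace_mul_hermForm_swap h hlam, map_neg, hxy, neg_zero]
  zero := trivial
  smul _ _ _ := trivial
  add _ _ _ _ _ := trivial
  self x _ := by
    rw [← Algebra.trace_trace (S := L₀), trace_mul_hermForm_self h hlam, map_zero]

theorem trace_mul_hermForm_eq_polar (x y : Fin n → L) :
    Algebra.trace K L (lam * hermForm L₀ x y) =
      polar (traceQuadraticForm K (hermNormForm h n)) x (-lam • y) := by
  have hneg : (-lam) ^ Nat.card L₀ = lam := by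
    have hsum := add_pow_natCard L₀ lam (-lam)
    rw [add_neg_cancel, zero_pow Nat.card_pos.ne'] at hsum
    linear_combination -hlam - hsum
  rw [polar_traceQuadraticForm_hermNormForm, hermForm_smul_right, hneg]

end

include h in
theorem IsMOvoid.card_le_of_symplectic [Finite K] [Fintype L] (hn : Odd n) {lam : L}
    (hlam0 : lam ≠ 0) (hlam : lam + lam ^ Nat.card L₀ = 0) {m : ℕ} {𝒯 : Set L₀} (hne : 𝒯.Nonempty)
    (h𝒯 : IsInvariantSet (nonzeroSquares K) 𝒯)
    (hm : (m * (Nat.card K - 1) * Nat.card L₀ : ℝ) = √(Fintype.card (Fin n → L)) * 𝒯.ncard)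
    (hM : IsMOvoid (TotallyIsotropic
      fun x y : Fin n → L => Algebra.trace K L (lam * hermForm L₀ x y)) m
      (pointsWithValueIn K (hermNorm L₀) 𝒯)) :
    (Nat.card L₀ : ℝ) ≤ 𝒯.ncard * (2 * √(Nat.card L₀) + 1) := by
  obtain ⟨χ, hχ⟩ := exists_addChar_ne_one K
  have hR := isMinusType_hermNormForm h hn
  have hinj : Function.Injective (DistribSMul.toLinearMap K (Fin n → L) (-lam)) :=
    smul_right_injective _ (neg_ne_zero.2 hlam0)
  refine IsMOvoid.card_le (R := hermNormForm h n) (isPolarForm_trace_mul_hermForm h hlam)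
    (fun W => ?_) one_pos
    (hasMinusPerpCounts_of_eq_polar hR.traceQuadraticForm hinj
      (trace_mul_hermForm_eq_polar h hlam)) hR (traceChar_ne_one hχ) hχ
    (fun x hx => smul_ne_zero (neg_ne_zero.2 hlam0) hx) (fun x y => ?_) (fun h0 => h𝒯.1 0 h0 rfl)
    hne (fun c hc x hx => ?_) hm hM
  · exact ⟨fun hW x hx => ⟨trivial, hW x hx⟩, fun hW x hx => (hW hx).2⟩
  · rw [trace_mul_hermForm_eq_polar h hlam, polar_traceQuadraticForm, traceChar_apply]
  · rw [coe_hermNormForm, hermNorm_smul_of_tower h]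
    exact h𝒯.2 _ ⟨mul_ne_zero hc hc, c, rfl⟩ _ hx

end Symplectic

section HermitianSubfield

open QuadraticMap (polar)

theorem trace_pow_natCard {K L : Type*} (L₀ : Type*) [Field K] [Field L₀] [Field L] [Finite K]
    [Finite L₀] [Finite L] [Algebra K L] [Algebra L₀ L] (z : L) :
    Algebra.trace K L (z ^ Nat.card L₀) = Algebra.trace K L z ^ Nat.card L₀ := by
  apply (algebraMap K L).injective
  rw [RingHom.map_pow, FiniteField.algebraMap_trace_eq_sum_pow,
    FiniteField.algebraMap_trace_eq_sum_pow, sum_pow_natCard L₀]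
  exact Finset.sum_congr rfl fun i _ => pow_right_comm _ _ _

variable {K₀ K L₀ L : Type*} [Field K₀] [Field K] [Field L₀] [Field L] [Finite K] [Finite L]
  [Algebra K₀ K] [Algebra K L] [Algebra L₀ L] (hK : Module.finrank K₀ K = 2)
  (hL : Module.finrank L₀ L = 2) {n : ℕ}
include hK hL

theorem natCard_eq_pow_finrank : Nat.card L₀ = Nat.card K₀ ^ Module.finrank K L := by
  refine Nat.pow_left_injective two_ne_zero ?_
  dsimp only
  rw [pow_right_comm, ← hK, ← Module.natCard_eq_pow_finrank, ← Module.natCard_eq_pow_finrank, hK,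
    ← hL, ← Module.natCard_eq_pow_finrank]

variable (hb : Odd (Module.finrank K L))
include hb

theorem pow_natCard_of_odd (c : K) : c ^ Nat.card L₀ = c ^ Nat.card K₀ := by
  have := Fintype.ofFinite K
  obtain ⟨j, hj⟩ := hb
  rw [natCard_eq_pow_finrank (K := K) hK hL, hj, pow_succ, pow_mul _ 2 j, ← hK,
    ← Module.natCard_eq_pow_finrank, pow_mul, Nat.card_eq_fintype_card (α := K),
    FiniteField.pow_card_pow]

variable [Algebra K₀ L₀] [Algebra K₀ L] [IsScalarTower K₀ K L] [IsScalarTower K₀ L₀ L]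

theorem norm_algebraMap_of_odd (c : K) :
    Algebra.norm L₀ (algebraMap K L c) = algebraMap K₀ L₀ (Algebra.norm K₀ c) := by
  apply (algebraMap L₀ L).injective
  rw [← IsScalarTower.algebraMap_apply K₀ L₀ L, IsScalarTower.algebraMap_apply K₀ K L,
    FiniteField.algebraMap_norm_eq_prod_pow, FiniteField.algebraMap_norm_eq_prod_pow, hK, hL]
  simp only [Finset.prod_range_succ, Finset.prod_range_zero, pow_zero, pow_one, one_mul]
  rw [map_mul, ← map_pow, pow_natCard_of_odd hK hL hb]

theorem hermNorm_smul_of_odd (c : K) (x : Fin n → L) :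
    hermNorm L₀ (c • x) = Algebra.norm K₀ c • hermNorm L₀ x := by
  rw [← algebraMap_smul L c x, hermNorm_smul, norm_algebraMap_of_odd hK hL hb, Algebra.smul_def]

variable [Finite K₀] [Finite L₀]

theorem trace_algebraMap_of_odd (c : K) :
    Algebra.trace L₀ L (algebraMap K L c) = algebraMap K₀ L₀ (Algebra.trace K₀ K c) := by
  apply (algebraMap L₀ L).injective
  rw [algebraMap_trace_natCard hL, ← IsScalarTower.algebraMap_apply K₀ L₀ L,
    IsScalarTower.algebraMap_apply K₀ K L, algebraMap_trace_natCard hK, map_add, ← map_pow,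
    pow_natCard_of_odd hK hL hb]

theorem trace_algebraMap_eq (a : L₀) :
    Algebra.trace K L (algebraMap L₀ L a) = algebraMap K₀ K (Algebra.trace K₀ L₀ a) := by
  refine sub_eq_zero.1 (eq_zero_of_trace_mul_eq_zero (K₀ := K₀) fun c => ?_)
  have hleft : Algebra.trace K₀ K (c * Algebra.trace K L (algebraMap L₀ L a)) =
      Algebra.trace K₀ K c * Algebra.trace K₀ L₀ a := by
    rw [← smul_eq_mul c, ← map_smul, Algebra.trace_trace, ← Algebra.trace_trace (S := L₀),
      Algebra.smul_def, mul_comm, ← Algebra.smul_def, map_smul, trace_algebraMap_of_odd hK hL hb,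
      smul_eq_mul, mul_comm, ← Algebra.smul_def, map_smul, smul_eq_mul]
  have hright : Algebra.trace K₀ K (c * algebraMap K₀ K (Algebra.trace K₀ L₀ a)) =
      Algebra.trace K₀ K c * Algebra.trace K₀ L₀ a := by
    rw [mul_comm, ← Algebra.smul_def, map_smul, smul_eq_mul, mul_comm]
  rw [mul_sub, map_sub, hleft, hright, sub_self]

theorem trace_hermForm_self (x : Fin n → L) :
    Algebra.trace K L (hermForm L₀ x x) =
      algebraMap K₀ K (Algebra.trace K₀ L₀ (hermNorm L₀ x)) := by
  rw [← algebraMap_hermNorm L₀ hL, trace_algebraMap_eq hK hL hb]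

omit hK hb [Finite K₀] in
theorem polar_traceQuadraticForm_eq_trace_trace (x y : Fin n → L) :
    polar (traceQuadraticForm K₀ (hermNormForm hL n)) x y =
      Algebra.trace K₀ K (Algebra.trace K L (hermForm L₀ x y)) := by
  rw [polar_traceQuadraticForm_hermNormForm, Algebra.trace_trace]

theorem isPolarForm_trace_hermForm :
    IsPolarForm (fun x y : Fin n → L => Algebra.trace K L (hermForm L₀ x y))
      (traceQuadraticForm K₀ (hermNormForm hL n) · = 0) where
  add_left x y z := by rw [hermForm_add_left, map_add]
  smul_left := trace_hermForm_smul_left L₀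
  refl x y hxy := by rw [hermForm_swap hL, trace_pow_natCard, hxy, zero_pow Nat.card_pos.ne']
  zero := QuadraticMap.map_zero _
  smul c x hx := by
    rw [traceQuadraticForm_apply, coe_hermNormForm] at hx ⊢
    rw [hermNorm_smul_of_odd hK hL hb, map_smul, hx, smul_zero]
  add x y hx hy hxy := by
    rw [QuadraticMap.map_add (traceQuadraticForm K₀ _), hx, hy,
      polar_traceQuadraticForm_eq_trace_trace (K := K), hxy, map_zero, add_zero, add_zero]
  self x hx := by
    rw [traceQuadraticForm_apply, coe_hermNormForm] at hx
    rw [trace_hermForm_self hK hL hb, hx, map_zero]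

theorem totallyIsotropic_iff_totallyPolar (W : Submodule K (Fin n → L)) :
    TotallyIsotropic (fun x y => Algebra.trace K L (hermForm L₀ x y)) W ↔
      TotallyPolar (fun x y => Algebra.trace K L (hermForm L₀ x y))
        (traceQuadraticForm K₀ (hermNormForm hL n) · = 0) W := by
  refine ⟨fun hW x hx => ⟨(algebraMap K₀ K).injective ?_, hW x hx⟩, fun hW x hx => (hW hx).2⟩
  rw [traceQuadraticForm_apply, coe_hermNormForm, ← trace_hermForm_self hK hL hb, map_zero]
  exact hW x hx x hx

theorem IsMOvoid.card_le_of_hermitian [Fintype L] (hn : Odd n) {m : ℕ} {𝒯 : Set L₀}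
    (hne : 𝒯.Nonempty) (h𝒯 : IsInvariantSet (nonzeroElements K₀) 𝒯)
    (hm : (m * (Nat.card K - 1) * Nat.card L₀ : ℝ) = √(Fintype.card (Fin n → L)) * 𝒯.ncard)
    (hM : IsMOvoid (TotallyIsotropic
      fun x y : Fin n → L => Algebra.trace K L (hermForm L₀ x y)) m
      (pointsWithValueIn K (hermNorm L₀) 𝒯)) :
    (Nat.card L₀ : ℝ) ≤ 𝒯.ncard * (2 * √(Nat.card L₀) + 1) := by
  obtain ⟨χ, hχ⟩ := exists_addChar_ne_one K₀
  have hR := isMinusType_hermNormForm hL hn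
  have hpolar := isPolarForm_trace_hermForm hK hL hb (n := n)
  refine IsMOvoid.card_le (R := hermNormForm hL n) (θ := id) hpolar
    (totallyIsotropic_iff_totallyPolar hK hL hb) (by exact_mod_cast Nat.card_pos)
    (hpolar.hasMinusPerpCounts hR.traceQuadraticForm
      (polar_traceQuadraticForm_eq_trace_trace hL)) hR (traceChar_ne_one hχ)
    (traceChar_ne_one (E := K) hχ) (fun _ => id) (fun x y => ?_) (fun h0 => h𝒯.1 0 h0 rfl) hne
    (fun c hc x hx => ?_) hm hM
  · rw [id, traceChar_apply, traceChar_apply, ← polar_traceQuadraticForm_eq_trace_trace hL,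
      polar_traceQuadraticForm]
  · rw [coe_hermNormForm, hermNorm_smul_of_odd hK hL hb]
    exact h𝒯.2 _ (Algebra.norm_ne_zero_iff.2 hc) _ hx

end HermitianSubfield

section Bounds

theorem IsCosetReps.div_le_card {K E : Type*} [Field K] [Field E] [Algebra K E] {G : Set K}
    {𝒯 : Set E} {T : Finset E} {F : ℝ} (hT : IsCosetReps G 𝒯 T) (h𝒯 : IsInvariantSet G 𝒯)
    (h : F ≤ 𝒯.ncard * (2 * √F + 1)) : F / (G.ncard * (2 * √F + 1)) ≤ #T := by
  refine div_le_of_le_mul₀ (by positivity) (by positivity) ?_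
  rwa [← mul_assoc, ← Nat.cast_mul, ← hT.ncard_eq h𝒯]

theorem IsCosetReps.mul_eq_of_nonzeroSquares {K E : Type*} [Field K] [Finite K] [Field E]
    [Algebra K E] {𝒯 : Set E} {T : Finset E} (hT : IsCosetReps (nonzeroSquares K) 𝒯 T)
    (h𝒯 : IsInvariantSet (nonzeroSquares K) 𝒯) {m s F : ℝ} (hF : F ≠ 0)
    (hm : m = epsilon (Nat.card K) * #T * (s / F)) :
    m * (Nat.card K - 1) * F = s * 𝒯.ncard := by
  rw [hT.ncard_eq h𝒯, Nat.cast_mul, ncard_nonzeroSquares, hm]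
  field_simp

theorem natCard_rpow_finrank (K L : Type*) [Field K] [Field L] [Finite L] [Algebra K L] :
    (Nat.card K : ℝ) ^ (Module.finrank K L : ℝ) = Nat.card L := by
  rw [Real.rpow_natCast, ← Nat.cast_pow, ← Module.natCard_eq_pow_finrank]

theorem natCard_rpow_finrank_div_two_eq_sqrt (K L : Type*) [Field K] [Field L] [Finite L]
    [Algebra K L] : (Nat.card K : ℝ) ^ ((Module.finrank K L : ℝ) / 2) = √(Nat.card L) := by
  rw [← natCard_rpow_finrank K L, Real.sqrt_eq_rpow, ← Real.rpow_mul (Nat.cast_nonneg _),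
    ← div_eq_mul_one_div]

theorem IsMOvoid.card_cosetReps_ge_of_ellipticForm {K L : Type*} [Field K] [Field L] [Finite K]
    [Finite L] [Algebra K L] {k m : ℕ} {a₀ a₁ : L} {𝒯 : Set L} {T : Finset L}
    (ha : Irreducible (X ^ 2 + C a₀ * X + C a₁)) (hne : 𝒯.Nonempty)
    (h𝒯 : IsInvariantSet (nonzeroSquares K) 𝒯) (hT : IsCosetReps (nonzeroSquares K) 𝒯 T)
    (hm : (m : ℝ) = epsilon (Nat.card K) * #T * (Nat.card K : ℝ) ^
      ((((2 * k + 2) * Module.finrank K L : ℕ) : ℝ) / 2 - Module.finrank K L))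
    (hM : IsMOvoid (TotallySingular
      fun x : Fin (2 * k + 2) → L => Algebra.trace K L (ellipticForm a₀ a₁ x)) m
      (pointsWithValueIn K (ellipticForm (k := k) a₀ a₁) 𝒯)) :
    (#T : ℝ) ≥ (Nat.card K : ℝ) ^ (Module.finrank K L : ℝ) /
      (epsilon (Nat.card K) * ((Nat.card K : ℝ) - 1) *
        (2 * (Nat.card K : ℝ) ^ ((Module.finrank K L : ℝ) / 2) + 1)) := by
  have := Fintype.ofFinite L
  have hK : (0 : ℝ) < Nat.card K := by exact_mod_cast Nat.card_pos
  have hexp : (((2 * k + 2) * Module.finrank K L : ℕ) : ℝ) / 2 - Module.finrank K L =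
      Module.finrank K L * ((k + 1 : ℕ) : ℝ) - Module.finrank K L := by
    push_cast
    ring
  rw [hexp, Real.rpow_sub hK, Real.rpow_mul_natCast hK.le, natCard_rpow_finrank,
    ← sqrt_card_pi_two_mul_add_two] at hm
  rw [natCard_rpow_finrank, natCard_rpow_finrank_div_two_eq_sqrt, ← ncard_nonzeroSquares]
  rw [← coe_ellipticQuadraticForm] at hM
  exact hT.div_le_card h𝒯 (hM.card_le_of_totallySingular (isMinusType_ellipticQuadraticForm ha) hne
    h𝒯 (hT.mul_eq_of_nonzeroSquares h𝒯 (by exact_mod_cast Nat.card_pos.ne') hm))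

section HermitianTower

variable {K L₀ L : Type*} [Field K] [Field L₀] [Field L] [Finite L] [Algebra K L]
  [Algebra L₀ L] (h : Module.finrank L₀ L = 2)
include h

theorem natCard_rpow_finrank_div_two :
    (Nat.card K : ℝ) ^ ((Module.finrank K L : ℝ) / 2) = Nat.card L₀ := by
  rw [natCard_rpow_finrank_div_two_eq_sqrt, Module.natCard_eq_pow_finrank (K := L₀), h,
    Nat.cast_pow, Real.sqrt_sq (Nat.cast_nonneg _)]

theorem natCard_rpow_finrank_div_four :
    (Nat.card K : ℝ) ^ ((Module.finrank K L : ℝ) / 4) = √(Nat.card L₀) := by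
  rw [← natCard_rpow_finrank_div_two (K := K) h, Real.sqrt_eq_rpow,
    ← Real.rpow_mul (Nat.cast_nonneg _)]
  ring_nf

theorem natCard_rpow_mul_finrank_sub_div_two [Finite K] [Fintype L] (n : ℕ) :
    (Nat.card K : ℝ) ^ ((((n * Module.finrank K L : ℕ) : ℝ) - Module.finrank K L) / 2) =
      √(Fintype.card (Fin n → L)) / Nat.card L₀ := by
  have hK : (0 : ℝ) < Nat.card K := by exact_mod_cast Nat.card_pos
  have hexp : (((n * Module.finrank K L : ℕ) : ℝ) - Module.finrank K L) / 2 =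
      (Module.finrank K L / 2 : ℝ) * n - (Module.finrank K L / 2 : ℝ) := by
    push_cast
    ring
  rw [hexp, Real.rpow_sub hK, Real.rpow_mul_natCast hK.le, natCard_rpow_finrank_div_two h,
    sqrt_card_pi_of_finrank_two h]

variable [Finite K] [Finite L₀] {n m : ℕ} {𝒯 : Set L₀} {T : Finset L₀} (hne : 𝒯.Nonempty)
include hne

theorem IsMOvoid.card_cosetReps_ge_of_hermitian {K₀ : Type*} [Field K₀] [Finite K₀] [Algebra K₀ K]
    [Algebra K₀ L₀] [Algebra K₀ L] [IsScalarTower K₀ K L] [IsScalarTower K₀ L₀ L]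
    (hK : Module.finrank K₀ K = 2) (hodd : Odd (n * Module.finrank K L))
    (h𝒯 : IsInvariantSet (nonzeroElements K₀) 𝒯) (hT : IsCosetReps (nonzeroElements K₀) 𝒯 T)
    (hm : (m : ℝ) = #T / ((Nat.card K : ℝ) ^ (1 / 2 : ℝ) + 1) * (Nat.card K : ℝ) ^
      ((((n * Module.finrank K L : ℕ) : ℝ) - Module.finrank K L) / 2))
    (hM : IsMOvoid (TotallyIsotropic
      fun x y : Fin n → L => Algebra.trace K L (hermForm L₀ x y)) m
      (pointsWithValueIn K (hermNorm L₀) 𝒯)) :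
    (#T : ℝ) ≥ (Nat.card K : ℝ) ^ ((Module.finrank K L : ℝ) / 2) /
      (((Nat.card K : ℝ) ^ (1 / 2 : ℝ) - 1) *
        (2 * (Nat.card K : ℝ) ^ ((Module.finrank K L : ℝ) / 4) + 1)) := by
  have := Fintype.ofFinite L
  have hsq : (Nat.card K : ℝ) = (Nat.card K₀ : ℝ) ^ 2 := by
    rw [Module.natCard_eq_pow_finrank (K := K₀), hK, Nat.cast_pow]
  have hsqrt : (Nat.card K : ℝ) ^ (1 / 2 : ℝ) = Nat.card K₀ := by
    rw [← Real.sqrt_eq_rpow, hsq, Real.sqrt_sq (Nat.cast_nonneg _)]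
  rw [hsqrt, natCard_rpow_mul_finrank_sub_div_two h] at hm
  rw [natCard_rpow_finrank_div_two h, natCard_rpow_finrank_div_four h, hsqrt,
    ← ncard_nonzeroElements]
  refine hT.div_le_card h𝒯 (hM.card_le_of_hermitian hK h (Nat.odd_mul.1 hodd).2
    (Nat.odd_mul.1 hodd).1 hne h𝒯 ?_)
  have hL₀ : (Nat.card L₀ : ℝ) ≠ 0 := by exact_mod_cast Nat.card_pos.ne'
  rw [hT.ncard_eq h𝒯, Nat.cast_mul, ncard_nonzeroElements, hm, hsq]
  field_simp
  ring

variable [Algebra K L₀] [IsScalarTower K L₀ L] (hn : Odd n)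
  (h𝒯 : IsInvariantSet (nonzeroSquares K) 𝒯) (hT : IsCosetReps (nonzeroSquares K) 𝒯 T)
  (hm : (m : ℝ) = epsilon (Nat.card K) * #T * (Nat.card K : ℝ) ^
    ((((n * Module.finrank K L : ℕ) : ℝ) - Module.finrank K L) / 2))
include hn h𝒯 hT hm

theorem IsMOvoid.card_cosetReps_ge_of_hermNorm
    (hM : IsMOvoid (TotallySingular
      fun x : Fin n → L => Algebra.trace K L₀ (hermNorm L₀ x)) m
      (pointsWithValueIn K (hermNorm (L := L) (n := n) L₀) 𝒯)) :
    (#T : ℝ) ≥ (Nat.card K : ℝ) ^ ((Module.finrank K L : ℝ) / 2) /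
      (epsilon (Nat.card K) * ((Nat.card K : ℝ) - 1) *
        (2 * (Nat.card K : ℝ) ^ ((Module.finrank K L : ℝ) / 4) + 1)) := by
  have := Fintype.ofFinite L
  rw [natCard_rpow_mul_finrank_sub_div_two h] at hm
  rw [natCard_rpow_finrank_div_two h, natCard_rpow_finrank_div_four h, ← ncard_nonzeroSquares]
  exact hT.div_le_card h𝒯 (IsMOvoid.card_le_of_totallySingular (isMinusType_hermNormForm h hn) hne
    h𝒯 (hT.mul_eq_of_nonzeroSquares h𝒯 (by exact_mod_cast Nat.card_pos.ne') hm) hM)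

theorem IsMOvoid.card_cosetReps_ge_of_symplectic {lam : L} (hlam0 : lam ≠ 0)
    (hlam : lam + lam ^ Nat.card L₀ = 0)
    (hM : IsMOvoid (TotallyIsotropic
      fun x y : Fin n → L => Algebra.trace K L (lam * hermForm L₀ x y)) m
      (pointsWithValueIn K (hermNorm L₀) 𝒯)) :
    (#T : ℝ) ≥ (Nat.card K : ℝ) ^ ((Module.finrank K L : ℝ) / 2) /
      (epsilon (Nat.card K) * ((Nat.card K : ℝ) - 1) *
        (2 * (Nat.card K : ℝ) ^ ((Module.finrank K L : ℝ) / 4) + 1)) := by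
  have := Fintype.ofFinite L
  rw [natCard_rpow_mul_finrank_sub_div_two h] at hm
  rw [natCard_rpow_finrank_div_two h, natCard_rpow_finrank_div_four h, ← ncard_nonzeroSquares]
  exact hT.div_le_card h𝒯 (hM.card_le_of_symplectic h hn hlam0 hlam hne h𝒯
    (hT.mul_eq_of_nonzeroSquares h𝒯 (by exact_mod_cast Nat.card_pos.ne') hm))

end HermitianTower

end Bounds

end PolarSpace

end

theorem mainTheorem9 :
    -- `H(d-1,q)` from `H(d/b-1,q^b)`, `d` odd; `|K₀| = q^(1/2)`, `|L₀| = q^(b/2)`, `|L| = q^b`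
    (∀ (K₀ K L₀ L : Type*) [Field K₀] [Field K] [Field L₀] [Field L]
        [Finite K₀] [Finite K] [Finite L₀] [Finite L]
        [Algebra K₀ K] [Algebra K₀ L₀] [Algebra K₀ L] [Algebra K L] [Algebra L₀ L]
        [IsScalarTower K₀ K L] [IsScalarTower K₀ L₀ L]
        (q b d n m : ℕ) (𝒯 : Set L₀) (T : Finset L₀),
        Nat.card K = q → Module.finrank K₀ K = 2 → Module.finrank L₀ L = 2 →
        Module.finrank K L = b → d = n * b → Odd d →
        𝒯.Nonempty →
        PolarSpace.IsInvariantSet (PolarSpace.nonzeroElements K₀) 𝒯 →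
        (∀ t ∈ 𝒯, Algebra.trace K₀ L₀ t = 0) →
        PolarSpace.IsCosetReps (PolarSpace.nonzeroElements K₀) 𝒯 T →
        (m : ℝ) = (T.card : ℝ) / ((q : ℝ) ^ (1 / 2 : ℝ) + 1) *
          (q : ℝ) ^ (((d : ℝ) - (b : ℝ)) / 2) →
        PolarSpace.IsMOvoid
          (PolarSpace.TotallyIsotropic
            fun x y : Fin n → L => Algebra.trace K L (PolarSpace.hermForm L₀ x y))
          m (PolarSpace.pointsWithValueIn K (PolarSpace.hermNorm (L := L) (n := n) L₀) 𝒯) →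
        (T.card : ℝ) ≥ (q : ℝ) ^ ((b : ℝ) / 2) /
          (((q : ℝ) ^ (1 / 2 : ℝ) - 1) * (2 * (q : ℝ) ^ ((b : ℝ) / 4) + 1))) ∧
    -- `Q⁻(d-1,q)` from `Q⁻(d/b-1,q^b)`, `d/b = 2k+2 ≥ 4`; `|L| = q^b`
    (∀ (K L : Type*) [Field K] [Field L] [Finite K] [Finite L] [Algebra K L]
        (q b d k m : ℕ) (a₀ a₁ : L) (𝒯 : Set L) (T : Finset L),
        Nat.card K = q → Module.finrank K L = b → d = (2 * k + 2) * b → 2 * k + 2 ≥ 4 →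
        Irreducible (Polynomial.X ^ 2 + Polynomial.C a₀ * Polynomial.X + Polynomial.C a₁) →
        𝒯.Nonempty →
        PolarSpace.IsInvariantSet (PolarSpace.nonzeroSquares K) 𝒯 →
        (∀ t ∈ 𝒯, Algebra.trace K L t = 0) →
        PolarSpace.IsCosetReps (PolarSpace.nonzeroSquares K) 𝒯 T →
        (m : ℝ) = PolarSpace.epsilon q * (T.card : ℝ) * (q : ℝ) ^ ((d : ℝ) / 2 - (b : ℝ)) →
        PolarSpace.IsMOvoid
          (PolarSpace.TotallySingular
            fun x : Fin (2 * k + 2) → L => Algebra.trace K L (PolarSpace.ellipticForm a₀ a₁ x))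
          m (PolarSpace.pointsWithValueIn K (PolarSpace.ellipticForm (k := k) a₀ a₁) 𝒯) →
        (T.card : ℝ) ≥ (q : ℝ) ^ (b : ℝ) /
          (PolarSpace.epsilon q * ((q : ℝ) - 1) * (2 * (q : ℝ) ^ ((b : ℝ) / 2) + 1))) ∧
    -- `Q⁻(d-1,q)` from `H(d/b-1,q^b)`, `b` even, `d/b = n` odd; `|L₀| = q^(b/2)`, `|L| = q^b`
    (∀ (K L₀ L : Type*) [Field K] [Field L₀] [Field L] [Finite K] [Finite L₀] [Finite L]
        [Algebra K L₀] [Algebra K L] [Algebra L₀ L] [IsScalarTower K L₀ L]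
        (q b d n m : ℕ) (𝒯 : Set L₀) (T : Finset L₀),
        Nat.card K = q → Module.finrank L₀ L = 2 →
        Module.finrank K L = b → d = n * b → Odd n →
        𝒯.Nonempty →
        PolarSpace.IsInvariantSet (PolarSpace.nonzeroSquares K) 𝒯 →
        (∀ t ∈ 𝒯, Algebra.trace K L₀ t = 0) →
        PolarSpace.IsCosetReps (PolarSpace.nonzeroSquares K) 𝒯 T →
        (m : ℝ) = PolarSpace.epsilon q * (T.card : ℝ) *
          (q : ℝ) ^ (((d : ℝ) - (b : ℝ)) / 2) →
        PolarSpace.IsMOvoid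
          (PolarSpace.TotallySingular
            fun x : Fin n → L => Algebra.trace K L₀ (PolarSpace.hermNorm L₀ x))
          m (PolarSpace.pointsWithValueIn K (PolarSpace.hermNorm (L := L) (n := n) L₀) 𝒯) →
        (T.card : ℝ) ≥ (q : ℝ) ^ ((b : ℝ) / 2) /
          (PolarSpace.epsilon q * ((q : ℝ) - 1) * (2 * (q : ℝ) ^ ((b : ℝ) / 4) + 1))) ∧
    -- `W(d-1,q)` from `H(d/b-1,q^b)`, `b` even, `d/b = n` odd; `|L₀| = q^(b/2)`, `|L| = q^b`
    (∀ (K L₀ L : Type*) [Field K] [Field L₀] [Field L] [Finite K] [Finite L₀] [Finite L]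
        [Algebra K L₀] [Algebra K L] [Algebra L₀ L] [IsScalarTower K L₀ L]
        (q b d n m : ℕ) (lam : L) (𝒯 : Set L₀) (T : Finset L₀),
        Nat.card K = q → Module.finrank L₀ L = 2 →
        Module.finrank K L = b → d = n * b → Odd n →
        lam ≠ 0 → lam + lam ^ Nat.card L₀ = 0 →
        𝒯.Nonempty →
        PolarSpace.IsInvariantSet (PolarSpace.nonzeroSquares K) 𝒯 →
        PolarSpace.IsCosetReps (PolarSpace.nonzeroSquares K) 𝒯 T →
        (m : ℝ) = PolarSpace.epsilon q * (T.card : ℝ) *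
          (q : ℝ) ^ (((d : ℝ) - (b : ℝ)) / 2) →
        PolarSpace.IsMOvoid
          (PolarSpace.TotallyIsotropic
            fun x y : Fin n → L => Algebra.trace K L (lam * PolarSpace.hermForm L₀ x y))
          m (PolarSpace.pointsWithValueIn K (PolarSpace.hermNorm (L := L) (n := n) L₀) 𝒯) →
        (T.card : ℝ) ≥ (q : ℝ) ^ ((b : ℝ) / 2) /
          (PolarSpace.epsilon q * ((q : ℝ) - 1) * (2 * (q : ℝ) ^ ((b : ℝ) / 4) + 1))) := by
  refine ⟨?_, ?_, ?_, ?_⟩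
  · rintro K₀ K L₀ L _ _ _ _ _ _ _ _ _ _ _ _ _ _ _ _ _ _ n m 𝒯 T rfl hK hL rfl rfl hodd hne h𝒯 -
      hT hm hM
    exact hM.card_cosetReps_ge_of_hermitian hL hne hK hodd h𝒯 hT hm
  · rintro K L _ _ _ _ _ _ _ _ k m a₀ a₁ 𝒯 T rfl rfl rfl - ha hne h𝒯 - hT hm hM
    exact hM.card_cosetReps_ge_of_ellipticForm ha hne h𝒯 hT hm
  · rintro K L₀ L _ _ _ _ _ _ _ _ _ _ _ _ _ n m 𝒯 T rfl hL rfl rfl hn hne h𝒯 - hT hm hM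
    exact hM.card_cosetReps_ge_of_hermNorm hL hne hn h𝒯 hT hm
  · rintro K L₀ L _ _ _ _ _ _ _ _ _ _ _ _ _ n m lam 𝒯 T rfl hL rfl rfl hn hlam0 hlam hne h𝒯 hT hm
      hM
    exact hM.card_cosetReps_ge_of_symplectic hL hne hn h𝒯 hT hm hlam0 hlam
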